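/- Let $d\ge 2$. Let $\mathcal S(\mathbb R^d)$ be the space of complex-valued Schwartz functions and let $\Delta^{\rm cl}f^\star=-(-\Delta+m^2)f$ with $m=0$ be the classical Batalin–Vilkovisky operator of the massless free scalar theory, regarded as a two-term complex $\mathcal S(\mathbb R^d)^{-1}\xrightarrow{\Delta^{\rm cl}}\mathcal S(\mathbb R^d)^{0}$ in degrees $-1$ and $0$. Let $$\mathrm{Obs}^{\rm cl}_{\mathcal S}(\mathbb R^d)=\mathrm{Sym}\big(\mathcal S(\mathbb R^d)^{-1}\xrightarrow{\Delta^{\rm cl}}\mathcal S(\mathbb R^d)^{0}\big)$$ be its (algebraic) graded-symmetric algebra over $\mathbb C$: its part of degree $-n$ is $\bigwedge^n\mathcal S(\mathbb R^d)\otimes\mathrm{Sym}(\mathcal S(\mathbb R^d))$ for $n\ge 0$, its part of positive degree is zero, and its differential is $P*f_0^\star*\cdots*f_n^\star\mapsto\sum_{i}(-1)^iP*(\Delta^{\rm cl}f_i^\star)*f_0^\star*\cdots\widehat{f_i^\star}\cdots*f_n^\star$. For $k\ge 0$ let $\mathscr H_k$ be the finite-dimensional space of complex harmonic polynomials on $\mathbb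 R^d$ that are homogeneous of degree $k$. Choose a basis $(\phi_{k,j})_j$ of every $\mathscr H_k$ (for example one that is orthonormal for the Fisher inner product $(\phi|\psi)=[\overline{\phi}(\partial)\psi](0)$). Put $\langle\phi,f\rangle=\int_{\mathbb R^d}\overline{\phi(x)}f(x)\,dx$, define the linear map $$\tilde\pi^0:\mathcal S(\mathbb R^d)\to\prod_{k\ge0}\mathscr H_k,\qquad \tilde\pi^0(f)=\Big(\sum_j\langle\phi_{k,j},f\rangle\,\phi_{k,j}\Big)_{k\ge0},$$ let $\widetilde{\mathscr H}\subset\prod_k\mathscr H_k$ be its image, and let $\pi^0:\mathcal S(\mathbb R^d)\to\widetilde{\mathscr H}$ be the induced surjection. Then $$H^n\,\mathrm{Obs}^{\rm cl}_{\mathcal S}(\mathbb R^d)=\begin{cases}\mathrm{Sym}(\widetilde{\mathscr H})&(n=0),\\0&(n\in\mathbb Z,\ n\ne0).\end{cases}$$ Here the identification in degree $0$ is the canonical one: the algebra homomorphism $\mathrm{Sym}(\pi^0):\mathrm{Sym}(\mathcal S(\mathbb R^d))\to\mathrm{Sym}(\widetilde{\mathscr H})$ on observables of degree $0$ descends to an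 isomorphism $H^0\,\mathrm{Obs}^{\rm cl}_{\mathcal S}(\mathbb R^d)\cong\mathrm{Sym}(\widetilde{\mathscr H})$. Moreover, the dimension of $\widetilde{\mathscr H}$ (the cardinality of its bases) is at least countably infinite. -/

import Mathlib

open scoped TensorProduct SchwartzMap Laplacian ComplexConjugate

noncomputable section

namespace SchwartzObs

/-! ### The symmetric algebra of a two-term complex `V⁻¹ → W⁰` -/

section SymComplex

variable {V W : Type} [AddCommGroup V] [Module ℂ V] [AddCommGroup W] [Module ℂ W]

/-- The part of degree `-n` of the free graded-commutative algebra on `V` (placed in degree `-1`)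
and `W` (placed in degree `0`): the `n`-th exterior power of `V` times the symmetric algebra
of `W`. -/
abbrev SymDeg (V W : Type) [AddCommGroup V] [Module ℂ V] [AddCommGroup W] [Module ℂ W]
    (n : ℕ) : Type :=
  SymmetricAlgebra ℂ W ⊗[ℂ] ⋀[ℂ]^n V

/-- Contraction of one generator of degree `-1`: the alternating map
`v ↦ (f₁, …, fₙ) ↦ D v ⊗ (f₁ ∧ ⋯ ∧ fₙ)`, linear in `v`. -/
def contractOne (D : V →ₗ[ℂ] W) (n : ℕ) : V →ₗ[ℂ] V [⋀^Fin n]→ₗ[ℂ] SymDeg V W n where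
  toFun v := (TensorProduct.mk ℂ (SymmetricAlgebra ℂ W) (⋀[ℂ]^n V)
    (SymmetricAlgebra.ι ℂ W (D v))).compAlternatingMap (exteriorPower.ιMulti ℂ n)
  map_add' v v' := by ext x; simp
  map_smul' c v := by ext x; simp [TensorProduct.smul_tmul']

/-- The differential of the symmetric algebra of the complex `D : V⁻¹ → W⁰`: the derivation
extending `D`, which vanishes on `W`. See `symD_tmul` for the formula. -/
def symD (D : V →ₗ[ℂ] W) (n : ℕ) : SymDeg V W (n + 1) →ₗ[ℂ] SymDeg V W n :=
  (LinearMap.liftBaseChange (SymmetricAlgebra ℂ W)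
    (exteriorPower.alternatingMapLinearEquiv
      (AlternatingMap.alternatizeUncurryFin (contractOne D n)))).restrictScalars ℂ

/-- `P * f₀ * ⋯ * fₙ ↦ ∑ᵢ (-1)ⁱ P * (D fᵢ) * f₀ * ⋯ f̂ᵢ ⋯ * fₙ`. -/
theorem symD_tmul (D : V →ₗ[ℂ] W) (n : ℕ) (P : SymmetricAlgebra ℂ W) (f : Fin (n + 1) → V) :
    symD D n (P ⊗ₜ exteriorPower.ιMulti ℂ (n + 1) f) =
      ∑ i : Fin (n + 1), (-1 : ℤ) ^ (i : ℕ) •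
        ((P * SymmetricAlgebra.ι ℂ W (D (f i))) ⊗ₜ[ℂ]
          exteriorPower.ιMulti ℂ n (i.removeNth f)) := by
  simp only [symD, LinearMap.coe_restrictScalars, LinearMap.liftBaseChange_tmul,
    exteriorPower.alternatingMapLinearEquiv_apply_ιMulti,
    AlternatingMap.alternatizeUncurryFin_apply, Finset.smul_sum]
  refine Finset.sum_congr rfl fun i _ => ?_
  rw [smul_comm]
  simp [contractOne, TensorProduct.smul_tmul']

theorem symD_comp (D : V →ₗ[ℂ] W) (n : ℕ) : symD D n ∘ₗ symD D (n + 1) = 0 := by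
  let F : V →ₗ[ℂ] V →ₗ[ℂ] V [⋀^Fin n]→ₗ[ℂ] SymDeg V W n :=
    LinearMap.mk₂ ℂ (fun x y => (TensorProduct.mk ℂ (SymmetricAlgebra ℂ W) (⋀[ℂ]^n V)
        (SymmetricAlgebra.ι ℂ W (D x) * SymmetricAlgebra.ι ℂ W (D y))).compAlternatingMap
          (exteriorPower.ιMulti ℂ n))
      (fun x x' y => by ext; simp [add_mul])
      (fun c x y => by ext; simp [TensorProduct.smul_tmul'])
      (fun x y y' => by ext; simp [mul_add])
      (fun c x y => by ext; simp [TensorProduct.smul_tmul'])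
  have hF : ∀ x y, F x y = F y x := fun x y => by
    ext; simp [F, mul_comm (SymmetricAlgebra.ι ℂ W (D x))]
  have key : ∀ v : Fin (n + 2) → V,
      symD D n (AlternatingMap.alternatizeUncurryFin (contractOne D (n + 1)) v) = 0 := by
    intro v
    have h0 := congrArg (fun a => a v)
      (AlternatingMap.alternatizeUncurryFin_alternatizeUncurryFinLM_comp_of_symmetric hF)
    refine Eq.trans ?_ h0
    rw [AlternatingMap.alternatizeUncurryFin_apply, AlternatingMap.alternatizeUncurryFin_apply,
      map_sum]
    refine Finset.sum_congr rfl fun i _ => ?_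
    rw [map_zsmul]
    congr 1
    simp only [symD, contractOne, LinearMap.coe_mk, AddHom.coe_mk,
      LinearMap.compAlternatingMap_apply, TensorProduct.mk_apply,
      LinearMap.coe_restrictScalars, LinearMap.liftBaseChange_tmul,
      exteriorPower.alternatingMapLinearEquiv_apply_ιMulti, LinearMap.comp_apply,
      AlternatingMap.alternatizeUncurryFinLM_apply, AlternatingMap.alternatizeUncurryFin_apply,
      Finset.smul_sum, F, LinearMap.mk₂_apply]
    refine Finset.sum_congr rfl fun j _ => ?_
    rw [smul_comm, TensorProduct.smul_tmul', smul_eq_mul]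
  refine TensorProduct.ext ?_
  refine LinearMap.ext fun P => exteriorPower.linearMap_ext ?_
  ext v
  have h1 : symD D (n + 1) (P ⊗ₜ exteriorPower.ιMulti ℂ (n + 2) v) =
      P • AlternatingMap.alternatizeUncurryFin (contractOne D (n + 1)) v := by
    simp only [symD, LinearMap.coe_restrictScalars, LinearMap.liftBaseChange_tmul,
      exteriorPower.alternatingMapLinearEquiv_apply_ιMulti]
  have h2 : ∀ x : SymDeg V W (n + 1), symD D n (P • x) = P • symD D n x := fun x => by
    simp only [symD, LinearMap.coe_restrictScalars, map_smul]
  change symD D n (symD D (n + 1) (P ⊗ₜ exteriorPower.ιMulti ℂ (n + 2) v)) = 0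
  rw [h1, h2, key, smul_zero]

/-- `Sym (V⁻¹ → W⁰)` as a chain complex: homological degree `n` is cohomological degree `-n`. -/
def symChain (D : V →ₗ[ℂ] W) : ChainComplex (ModuleCat.{0} ℂ) ℕ :=
  ChainComplex.of (fun n => ModuleCat.of ℂ (SymDeg V W n)) (fun n => ModuleCat.ofHom (symD D n))
    (fun n => by rw [← ModuleCat.ofHom_comp, symD_comp]; rfl)

/-- `Sym (V⁻¹ → W⁰)` as a cochain complex indexed by `ℤ`:
`⋯ → ⋀² V * Sym W → V * Sym W → Sym W → 0 → ⋯`, with `Sym W` in degree `0`. -/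
def symComplex (D : V →ₗ[ℂ] W) : CochainComplex (ModuleCat.{0} ℂ) ℤ :=
  (symChain D).extend ComplexShape.embeddingDownNat

/-- The identification of `Sym W` with the part of degree `0` of the complex. -/
def symDegZero (D : V →ₗ[ℂ] W) :
    ModuleCat.of ℂ (SymmetricAlgebra ℂ W) ⟶ (symComplex D).X 0 :=
  CategoryTheory.CategoryStruct.comp (Y := (symChain D).X 0)
    (ModuleCat.ofHom ((TensorProduct.mk ℂ (SymmetricAlgebra ℂ W) (⋀[ℂ]^0 V)).flip
      (exteriorPower.ιMulti ℂ 0 Fin.elim0)))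
    (HomologicalComplex.extendXIso (symChain D) ComplexShape.embeddingDownNat
      (i := 0) (i' := 0) rfl).inv

/-- The map sending an element of degree `0`, which is always a cocycle, to its class in `H⁰`. -/
def cohomClass (D : V →ₗ[ℂ] W) :
    ModuleCat.of ℂ (SymmetricAlgebra ℂ W) ⟶ (symComplex D).homology 0 :=
  CategoryTheory.CategoryStruct.comp
    ((symComplex D).liftCycles (symDegZero D) 1 (by simp) (by
      have h : (symComplex D).d 0 1 = 0 :=
        (HomologicalComplex.isZero_extend_X _ _ _ (by
          intro i hi
          have hi' : -(i : ℤ) = 1 := hi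
          omega)).eq_of_tgt _ _
      rw [h, CategoryTheory.Limits.comp_zero]))
    ((symComplex D).homologyπ 0)

end SymComplex

/-! ### Observables of the free scalar theory -/

/-- Complex-valued Schwartz functions on `ℝᵈ`. -/
abbrev Sch (d : ℕ) : Type := 𝓢(EuclideanSpace ℝ (Fin d), ℂ)

/-- The classical Batalin–Vilkovisky operator `f⋆ ↦ -(-Δ + m²) f`. -/
def bvOperator (d : ℕ) (m : ℝ) : Sch d →ₗ[ℂ] Sch d where
  toFun f := -(-Δ f + ((m : ℂ) ^ 2) • f)
  map_add' f g := by
    rw [← SchwartzMap.laplacianCLM_eq ℂ, ← SchwartzMap.laplacianCLM_eq ℂ,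
      ← SchwartzMap.laplacianCLM_eq ℂ, map_add, smul_add]
    abel
  map_smul' c f := by
    rw [← SchwartzMap.laplacianCLM_eq ℂ, ← SchwartzMap.laplacianCLM_eq ℂ, map_smul,
      RingHom.id_apply, smul_comm _ c, ← smul_neg, ← smul_add, ← smul_neg]

/-- The classical derived observables `Sym (𝓢(ℝᵈ)⁻¹ → 𝓢(ℝᵈ)⁰)` of the theory of mass `m`. -/
def obsCl (d : ℕ) (m : ℝ) : CochainComplex (ModuleCat.{0} ℂ) ℤ := symComplex (bvOperator d m)

/-- The class in `H⁰` of an observable of degree `0`. -/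
def obsClass (d : ℕ) (m : ℝ) :
    SymmetricAlgebra ℂ (Sch d) →ₗ[ℂ] (obsCl d m).homology 0 := (cohomClass (bvOperator d m)).hom

/-! ### Harmonic polynomials and the map `π⁰` -/

/-- The Laplacian `∑ᵢ ∂ᵢ²` on polynomials in `d` variables. -/
def polyLaplacian (d : ℕ) : MvPolynomial (Fin d) ℂ →ₗ[ℂ] MvPolynomial (Fin d) ℂ :=
  ∑ i, (MvPolynomial.pderiv i).toLinearMap ∘ₗ (MvPolynomial.pderiv i).toLinearMap

/-- The space `𝓗ₖ` of harmonic polynomials on `ℝᵈ`, homogeneous of degree `k`. -/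
def harmonicPoly (d k : ℕ) : Submodule ℂ (MvPolynomial (Fin d) ℂ) :=
  MvPolynomial.homogeneousSubmodule (Fin d) ℂ k ⊓ LinearMap.ker (polyLaplacian d)

/-- The function on `ℝᵈ` given by a polynomial. -/
def polyFun {d : ℕ} (p : MvPolynomial (Fin d) ℂ) (x : EuclideanSpace ℝ (Fin d)) : ℂ :=
  MvPolynomial.eval (fun i => (x i : ℂ)) p

theorem conj_polyFun_hasTemperateGrowth {d : ℕ} (p : MvPolynomial (Fin d) ℂ) :
    (fun x => conj (polyFun p x)).HasTemperateGrowth := by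
  have hc : (fun z : ℂ => conj z).HasTemperateGrowth :=
    Complex.conjCLE.toContinuousLinearMap.hasTemperateGrowth
  refine hc.comp (f := polyFun p) ?_
  induction p using MvPolynomial.induction_on with
  | C a =>
    have h : polyFun (d := d) (MvPolynomial.C a) = fun _ => a := by
      funext x; simp [polyFun]
    rw [h]
    exact Function.HasTemperateGrowth.const a
  | add p q hp hq =>
    have h : polyFun (p + q) = polyFun p + polyFun q := by
      funext x; simp [polyFun]
    rw [h]
    exact hp.add hq
  | mul_X p i hp =>
    have hx : (fun x : EuclideanSpace ℝ (Fin d) => ((x i : ℝ) : ℂ)).HasTemperateGrowth :=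
      (Complex.ofRealCLM.comp (EuclideanSpace.proj (𝕜 := ℝ) i)).hasTemperateGrowth
    have h : polyFun (p * MvPolynomial.X i) =
        polyFun p * fun x : EuclideanSpace ℝ (Fin d) => ((x i : ℝ) : ℂ) := by
      funext x; simp [polyFun]
    rw [h]
    exact hp.mul hx

theorem integrable_pairing {d : ℕ} (p : MvPolynomial (Fin d) ℂ) (f : Sch d) :
    MeasureTheory.Integrable (fun x => conj (polyFun p x) * f x) := by
  have h := (SchwartzMap.smulLeftCLM ℂ (fun x => conj (polyFun p x)) f).integrable
    (μ := MeasureTheory.volume)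
  rw [SchwartzMap.smulLeftCLM_apply (conj_polyFun_hasTemperateGrowth p)] at h
  exact h

/-- `⟨φ, f⟩ = ∫ conj (φ x) f x dx` for a polynomial `φ` and a Schwartz function `f`. -/
def pairing {d : ℕ} (p : MvPolynomial (Fin d) ℂ) : Sch d →ₗ[ℂ] ℂ where
  toFun f := ∫ x, conj (polyFun p x) * f x
  map_add' f g := by
    simp only [add_apply, mul_add]
    exact MeasureTheory.integral_add (integrable_pairing p f) (integrable_pairing p g)
  map_smul' c f := by
    simp only [smul_apply, smul_eq_mul, RingHom.id_apply, mul_left_comm _ c]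
    exact MeasureTheory.integral_const_mul c _

/-- A choice of a (finite) basis of `𝓗ₖ` for every `k`, that is, a homogeneous basis of the space
of all harmonic polynomials. -/
abbrev HarmonicBasis (d : ℕ) (N : ℕ → ℕ) : Type :=
  ∀ k, Module.Basis (Fin (N k)) ℂ (harmonicPoly d k)

/-- `π̃⁰ : 𝓢(ℝᵈ) → ∏ₖ 𝓗ₖ`, `f ↦ (∑ⱼ ⟨φₖⱼ, f⟩ φₖⱼ)ₖ`, where the `φₖⱼ` are the chosen basis. -/
def piTilde {d : ℕ} {N : ℕ → ℕ} (φ : HarmonicBasis d N) :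
    Sch d →ₗ[ℂ] ∀ k, harmonicPoly d k :=
  LinearMap.pi fun k => ∑ j, (pairing (φ k j : MvPolynomial (Fin d) ℂ)).smulRight (φ k j)

/-- `𝓗̃ ⊆ ∏ₖ 𝓗ₖ`, the image of `π̃⁰`. -/
def harmonicTilde {d : ℕ} {N : ℕ → ℕ} (φ : HarmonicBasis d N) :
    Submodule ℂ (∀ k, harmonicPoly d k) :=
  LinearMap.range (piTilde φ)

/-- `π⁰ : 𝓢(ℝᵈ) → 𝓗̃`. -/
def piZero {d : ℕ} {N : ℕ → ℕ} (φ : HarmonicBasis d N) : Sch d →ₗ[ℂ] harmonicTilde φ :=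
  (piTilde φ).rangeRestrict

/-- `Sym π⁰ : Sym 𝓢(ℝᵈ) → Sym 𝓗̃`. -/
def symPiZero {d : ℕ} {N : ℕ → ℕ} (φ : HarmonicBasis d N) :
    SymmetricAlgebra ℂ (Sch d) →ₐ[ℂ] SymmetricAlgebra ℂ (harmonicTilde φ) :=
  SymmetricAlgebra.lift (SymmetricAlgebra.ι ℂ (harmonicTilde φ) ∘ₗ piZero φ)

end SchwartzObs

end

/-! For m = 0 the operator D is the Laplacian Δ, and the complex is the Koszul complex of Δ over
Sym(𝓢).

Algebra. Suppose D : V → W is injective with left inverse s. The derivation h extending s, zero on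
V, gives Φ = Dh + hD, a derivation equal to the identity on V and to the projection Ds on W. It
counts factors from V and from the range of D, so it is diagonalizable with eigenvalues ≥ 1 as soon
as one factor of V is present. Hence it is invertible there and the complex is exact in nonzero
degrees. In degree 0 the cohomology is Sym W modulo the ideal generated by D(V), which is Sym(W /
D(V)).

Analysis. Δ is injective because |ξ|² 𝓕g = 0 forces the continuous 𝓕g to vanish. The range of Δ is
ker π⁰: integration by parts gives one inclusion (`moment_laplacian`). Conversely, let f be
orthogonal to all harmonic polynomials. By duality, f has the same moments up to any finite order as
some Δg (`exists_moment_eq_moment_laplacian`). Then 𝓕(f - Δg) vanishes to high order at 0, so 𝓕f /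
|ξ|² is of class C^m. The quotient does not depend on g, so it is smooth, and it is Schwartz; its
inverse Fourier transform solves Δg = f up to a constant.

Dimension. The powers (x + iy)^k are harmonic and give infinitely many independent functionals on 𝓢
that factor through π⁰. -/

noncomputable section

namespace SchwartzObs

/-! ### Koszul calculus: derivations, wedge products and the Cartan formula -/

section Koszul

variable {V W : Type} [AddCommGroup V] [Module ℂ V] [AddCommGroup W] [Module ℂ W]

/-- The universal property applied to w ↦ w + ε f(w) in the square-zero extension A ⊕ εM yields an
algebra map; its ε-part is the derivation. -/
theorem exists_derivation_symmetricAlgebra {M : Type} [AddCommGroup M] [Module ℂ M]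
    [Module (SymmetricAlgebra ℂ W) M] [IsScalarTower ℂ (SymmetricAlgebra ℂ W) M]
    (f : W →ₗ[ℂ] M) :
    ∃ D : SymmetricAlgebra ℂ W →ₗ[ℂ] M, (∀ a b, D (a * b) = a • D b + b • D a) ∧
      D 1 = 0 ∧ ∀ w, D (SymmetricAlgebra.ι ℂ W w) = f w := by
  let A := SymmetricAlgebra ℂ W
  -- The square-zero extension needs a right action; since A is commutative, the left one serves.
  let _ : Module Aᵐᵒᵖ M := Module.compHom M ((RingHom.id A).fromOpposite mul_comm)
  have : IsCentralScalar A M := ⟨fun a m => rfl⟩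
  let g : W →ₗ[ℂ] TrivSqZeroExt A M :=
    (TrivSqZeroExt.inlAlgHom ℂ A M).toLinearMap ∘ₗ SymmetricAlgebra.ι ℂ W +
      (TrivSqZeroExt.inrHom A M).restrictScalars ℂ ∘ₗ f
  let F := SymmetricAlgebra.lift g
  have hF : (TrivSqZeroExt.fstHom ℂ A M).comp F = AlgHom.id ℂ A := by
    refine SymmetricAlgebra.algHom_ext ?_
    ext w
    simp [F, g]
    rfl
  have hF' : ∀ a, (F a).fst = a := fun a => DFunLike.congr_fun hF a
  refine ⟨(TrivSqZeroExt.sndHom A M).restrictScalars ℂ ∘ₗ F.toLinearMap, fun a b => ?_,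
    ?_, fun w => ?_⟩
  · simp [hF']
  · simp
  · simp [F, g]

/-- Left multiplication by `v` in the exterior algebra. -/
def wedge (V : Type) [AddCommGroup V] [Module ℂ V] (n : ℕ) :
    V →ₗ[ℂ] ⋀[ℂ]^n V →ₗ[ℂ] ⋀[ℂ]^(n + 1) V :=
  LinearMap.mk₂ ℂ (fun v ω => ⟨ExteriorAlgebra.ι ℂ v * ω, by
      rw [ExteriorAlgebra.exteriorPower, pow_succ']
      exact Submodule.mul_mem_mul (LinearMap.mem_range_self _ v) ω.2⟩)
    (fun x y z => by ext; simp [add_mul]) (fun c x y => by ext; simp)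
    (fun x y z => by ext; simp [mul_add]) (fun c x y => by ext; simp)

theorem wedge_ιMulti (n : ℕ) (v : V) (f : Fin n → V) :
    wedge V n v (exteriorPower.ιMulti ℂ n f) =
      exteriorPower.ιMulti ℂ (n + 1) (Fin.cons v f : Fin (n + 1) → V) := by
  ext
  simp [wedge, ExteriorAlgebra.ιMulti_succ_apply, Matrix.vecTail, Function.comp_def]

/-- Left multiplication by a generator `v` of degree `-1`, up to sign. -/
def wedgeSym (V W : Type) [AddCommGroup V] [Module ℂ V] [AddCommGroup W] [Module ℂ W] (n : ℕ)
    (v : V) : SymDeg V W n →ₗ[SymmetricAlgebra ℂ W] SymDeg V W (n + 1) :=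
  (wedge V n v).baseChange (SymmetricAlgebra ℂ W)

theorem symDeg_ext {n : ℕ} {M : Type} [AddCommGroup M] [Module ℂ M]
    [Module (SymmetricAlgebra ℂ W) M] [IsScalarTower ℂ (SymmetricAlgebra ℂ W) M]
    {f g : SymDeg V W n →ₗ[SymmetricAlgebra ℂ W] M}
    (h : ∀ v : Fin n → V, f (1 ⊗ₜ exteriorPower.ιMulti ℂ n v) =
      g (1 ⊗ₜ exteriorPower.ιMulti ℂ n v)) : f = g := by
  refine TensorProduct.AlgebraTensorModule.ext fun P ω => ?_
  have h1 : f.restrictScalars ℂ ∘ₗ TensorProduct.mk ℂ (SymmetricAlgebra ℂ W) (⋀[ℂ]^n V) 1 =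
      g.restrictScalars ℂ ∘ₗ TensorProduct.mk ℂ (SymmetricAlgebra ℂ W) (⋀[ℂ]^n V) 1 := by
    refine exteriorPower.linearMap_ext ?_
    ext v
    exact h v
  have h2 := DFunLike.congr_fun h1 ω
  have h3 : P ⊗ₜ[ℂ] ω = P • ((1 : SymmetricAlgebra ℂ W) ⊗ₜ[ℂ] ω) := by
    rw [TensorProduct.smul_tmul', smul_eq_mul, mul_one]
  rw [h3, map_smul, map_smul]
  exact congrArg _ h2

/-- The differential as a map of modules over the symmetric algebra. -/
def symDLinear (D : V →ₗ[ℂ] W) (n : ℕ) :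
    SymDeg V W (n + 1) →ₗ[SymmetricAlgebra ℂ W] SymDeg V W n :=
  LinearMap.liftBaseChange (SymmetricAlgebra ℂ W)
    (exteriorPower.alternatingMapLinearEquiv
      (AlternatingMap.alternatizeUncurryFin (contractOne D n)))

theorem symDLinear_apply (D : V →ₗ[ℂ] W) (n : ℕ) (x : SymDeg V W (n + 1)) :
    symDLinear D n x = symD D n x := rfl

theorem symD_smul (D : V →ₗ[ℂ] W) (n : ℕ) (P : SymmetricAlgebra ℂ W) (x : SymDeg V W (n + 1)) :
    symD D n (P • x) = P • symD D n x := (symDLinear D n).map_smul P x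

/-- Graded Leibniz rule for v ∧ x: removing v itself gives the right side, and the remaining terms
cancel because v shifts every other index, hence every sign, by one. -/
theorem symD_wedgeSym (D : V →ₗ[ℂ] W) (n : ℕ) (v : V) (x : SymDeg V W (n + 1)) :
    symD D (n + 1) (wedgeSym V W (n + 1) v x) + wedgeSym V W n v (symD D n x) =
      SymmetricAlgebra.ι ℂ W (D v) • x := by
  have key : symDLinear D (n + 1) ∘ₗ wedgeSym V W (n + 1) v +
      wedgeSym V W n v ∘ₗ symDLinear D n =
        SymmetricAlgebra.ι ℂ W (D v) • LinearMap.id := by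
    refine symDeg_ext fun f => ?_
    simp only [LinearMap.add_apply, LinearMap.comp_apply, symDLinear_apply, wedgeSym,
      LinearMap.baseChange_tmul, wedge_ιMulti, symD_tmul, map_sum, LinearMap.smul_apply,
      LinearMap.id_apply, map_zsmul]
    rw [Fin.sum_univ_succ, add_assoc, ← Finset.sum_add_distrib, Finset.sum_eq_zero]
    · simp [TensorProduct.smul_tmul']
    · intro i _
      have : (i.succ.removeNth (Fin.cons v f : Fin (n + 2) → V) : Fin (n + 1) → V) =
          Fin.cons v (i.removeNth f) := by
        ext j
        refine Fin.cases ?_ (fun j => ?_) j <;> simp [Fin.removeNth]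
      simp [this, pow_succ]
  exact DFunLike.congr_fun key x

theorem symD_wedgeSym_zero (D : V →ₗ[ℂ] W) (v : V) (x : SymDeg V W 0) :
    symD D 0 (wedgeSym V W 0 v x) = SymmetricAlgebra.ι ℂ W (D v) • x := by
  have key : symDLinear D 0 ∘ₗ wedgeSym V W 0 v =
        SymmetricAlgebra.ι ℂ W (D v) • LinearMap.id := by
    refine symDeg_ext fun f => ?_
    simp only [LinearMap.comp_apply, symDLinear_apply, wedgeSym,
      LinearMap.baseChange_tmul, wedge_ιMulti, symD_tmul, LinearMap.smul_apply,
      LinearMap.id_apply]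
    simp [TensorProduct.smul_tmul']
  exact DFunLike.congr_fun key x

/-- A derivation of degree `-1` extending `s : W → V`. -/
theorem exists_symHomotopy (s : W →ₗ[ℂ] V) (n : ℕ) :
    ∃ h : SymDeg V W n →ₗ[ℂ] SymDeg V W (n + 1),
      (∀ ω, h (1 ⊗ₜ ω) = 0) ∧
      ∀ w x, h (SymmetricAlgebra.ι ℂ W w • x) =
        SymmetricAlgebra.ι ℂ W w • h x + wedgeSym V W n (s w) x := by
  -- The derivation takes values in linear maps on the exterior power, starting from w ↦ (ω ↦ 1 ⊗ (s
  -- w ∧ ω)); uncurrying it gives h.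
  obtain ⟨d, hd, h1, hd'⟩ := exists_derivation_symmetricAlgebra
    (M := ⋀[ℂ]^n V →ₗ[ℂ] SymDeg V W (n + 1))
    ((TensorProduct.mk ℂ (SymmetricAlgebra ℂ W) (⋀[ℂ]^(n + 1) V) 1).compRight ℂ ∘ₗ
      wedge V n ∘ₗ s)
  refine ⟨TensorProduct.lift d, fun ω => by simp [h1], fun w x => ?_⟩
  induction x using TensorProduct.induction_on with
  | zero => simp
  | add x y hx hy => rw [smul_add, map_add, hx, hy, map_add, map_add, smul_add]; abel
  | tmul P ω =>
    simp [TensorProduct.smul_tmul', hd, hd', wedgeSym]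

end Koszul

/-! ### Exactness of the Koszul complex, and its degree 0 -/

section KoszulExact

variable {V W : Type} [AddCommGroup V] [Module ℂ V] [AddCommGroup W] [Module ℂ W]

/-- The sum of the eigenspaces contains 1 ⊗ ω, with eigenvalue n + 1, and is stable under
multiplication by Sym W, so it is everything. -/
theorem iSup_eigenspace_eq_top (D : V →ₗ[ℂ] W) (s : W →ₗ[ℂ] V) (hs : ∀ v, s (D v) = v) (n : ℕ)
    (Φ : Module.End ℂ (SymDeg V W (n + 1)))
    (h1 : ∀ ω, Φ (1 ⊗ₜ ω) = ((n + 1 : ℕ) : ℂ) • (1 ⊗ₜ ω))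
    (h2 : ∀ w x, Φ (SymmetricAlgebra.ι ℂ W w • x) =
      SymmetricAlgebra.ι ℂ W w • Φ x + SymmetricAlgebra.ι ℂ W (D (s w)) • x) :
    ⨆ k : ℕ, Φ.eigenspace ((k + 1 : ℕ) : ℂ) = ⊤ := by
  set U := ⨆ k : ℕ, Φ.eigenspace ((k + 1 : ℕ) : ℂ) with hU
  have hmul : ∀ w, ∀ x ∈ U, SymmetricAlgebra.ι ℂ W w • x ∈ U := by
    intro w x hx
    -- Split w along W = range D ⊕ ker s: the first part raises the eigenvalue by one, the second
    -- preserves it.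
    have hw : SymmetricAlgebra.ι ℂ W w • x =
        SymmetricAlgebra.ι ℂ W (D (s w)) • x + SymmetricAlgebra.ι ℂ W (w - D (s w)) • x := by
      rw [← add_smul, ← map_add, add_sub_cancel]
    rw [hw]
    clear hw
    induction hx using Submodule.iSup_induction' with
    | zero => simp
    | add x y _ _ hx hy =>
      rw [smul_add, smul_add, add_add_add_comm]
      exact U.add_mem hx hy
    | mem k x hx =>
      rw [Module.End.mem_eigenspace_iff] at hx
      refine U.add_mem (Submodule.mem_iSup_of_mem (k + 1) ?_) (Submodule.mem_iSup_of_mem k ?_)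
      · rw [Module.End.mem_eigenspace_iff, h2, hx, hs, smul_comm, Nat.cast_succ (k + 1), add_smul,
          one_smul]
      · have h3 : s (w - D (s w)) = 0 := by rw [map_sub, hs, sub_self]
        rw [Module.End.mem_eigenspace_iff, h2, hx, h3, map_zero, map_zero, zero_smul, add_zero,
          smul_comm]
  have hall : ∀ P : SymmetricAlgebra ℂ W, ∀ x ∈ U, P • x ∈ U := by
    intro P
    induction P using SymmetricAlgebra.induction with
    | algebraMap r =>
      intro x hx
      rw [algebraMap_smul]
      exact U.smul_mem r hx
    | ι w => exact hmul w
    | mul a b ha hb => exact fun x hx => by rw [mul_smul]; exact ha _ (hb _ hx)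
    | add a b ha hb => exact fun x hx => by rw [add_smul]; exact U.add_mem (ha _ hx) (hb _ hx)
  refine eq_top_iff.mpr fun x _ => ?_
  induction x using TensorProduct.induction_on with
  | zero => exact U.zero_mem
  | add x y hx hy => exact U.add_mem (hx trivial) (hy trivial)
  | tmul P ω =>
    have h3 : P ⊗ₜ[ℂ] ω = P • ((1 : SymmetricAlgebra ℂ W) ⊗ₜ[ℂ] ω) := by
      rw [TensorProduct.smul_tmul', smul_eq_mul, mul_one]
    rw [h3]
    refine hall P _ (Submodule.mem_iSup_of_mem n ?_)
    rw [Module.End.mem_eigenspace_iff, h1]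

/-- No eigenvalue k + 1 is zero: independence of eigenspaces gives injectivity, division by k + 1
gives surjectivity. -/
theorem bijective_of_iSup_eigenspace_eq_top {M : Type} [AddCommGroup M] [Module ℂ M]
    (Φ : Module.End ℂ M) (h : ⨆ k : ℕ, Φ.eigenspace ((k + 1 : ℕ) : ℂ) = ⊤) :
    Function.Bijective Φ := by
  have h0 : ∀ k : ℕ, ((k + 1 : ℕ) : ℂ) ≠ 0 := fun k => Nat.cast_ne_zero.mpr (Nat.succ_ne_zero k)
  constructor
  · rw [← LinearMap.ker_eq_bot, ← Module.End.eigenspace_zero]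
    have hd := Φ.eigenspaces_iSupIndep 0
    rw [← disjoint_top]
    refine hd.mono_right (h.symm.le.trans (iSup_le fun k => ?_))
    exact le_iSup₂_of_le ((k + 1 : ℕ) : ℂ) (h0 k) le_rfl
  · rw [← LinearMap.range_eq_top, eq_top_iff, ← h]
    refine iSup_le fun k x hx => ⟨(((k + 1 : ℕ) : ℂ))⁻¹ • x, ?_⟩
    rw [Module.End.mem_eigenspace_iff] at hx
    rw [map_smul, hx, inv_smul_smul₀ (h0 k)]

theorem exists_symD_eq_of_symD_eq_zero (D : V →ₗ[ℂ] W) (hD : Function.Injective D) (n : ℕ)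
    (z : SymDeg V W (n + 1)) (hz : symD D n z = 0) : ∃ u, symD D (n + 1) u = z := by
  obtain ⟨s, hs⟩ := D.exists_leftInverse_of_injective (LinearMap.ker_eq_bot.mpr hD)
  have hs' : ∀ v, s (D v) = v := fun v => DFunLike.congr_fun hs v
  choose h h1 h2 using fun n => exists_symHomotopy (V := V) s n
  let Φ : ∀ n, Module.End ℂ (SymDeg V W (n + 1)) := fun n =>
    symD D (n + 1) ∘ₗ h (n + 1) + h n ∘ₗ symD D n
  have hbij : ∀ n, Function.Bijective (Φ n) := by
    intro n
    refine bijective_of_iSup_eigenspace_eq_top _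
      (iSup_eigenspace_eq_top D s hs' n (Φ n) (fun ω => ?_) fun w x => ?_)
    · have key : Φ n ∘ₗ TensorProduct.mk ℂ (SymmetricAlgebra ℂ W) (⋀[ℂ]^(n + 1) V) 1 =
          ((n + 1 : ℕ) : ℂ) • TensorProduct.mk ℂ (SymmetricAlgebra ℂ W) (⋀[ℂ]^(n + 1) V) 1 := by
        refine exteriorPower.linearMap_ext ?_
        ext f
        simp only [LinearMap.compAlternatingMap_apply, LinearMap.comp_apply,
          TensorProduct.mk_apply, Φ, LinearMap.add_apply, h1, map_zero, zero_add, symD_tmul,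
          map_sum, map_zsmul, one_mul, LinearMap.smul_apply]
        have hterm : ∀ i : Fin (n + 1), (-1 : ℤ) ^ (i : ℕ) •
            h n (SymmetricAlgebra.ι ℂ W (D (f i)) ⊗ₜ[ℂ]
              exteriorPower.ιMulti ℂ n (i.removeNth f)) =
            (1 : SymmetricAlgebra ℂ W) ⊗ₜ[ℂ] exteriorPower.ιMulti ℂ (n + 1) f := by
          intro i
          have h3 : SymmetricAlgebra.ι ℂ W (D (f i)) ⊗ₜ[ℂ]
              exteriorPower.ιMulti ℂ n (i.removeNth f) = SymmetricAlgebra.ι ℂ W (D (f i)) •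
                ((1 : SymmetricAlgebra ℂ W) ⊗ₜ[ℂ] exteriorPower.ιMulti ℂ n (i.removeNth f)) := by
            rw [TensorProduct.smul_tmul', smul_eq_mul, mul_one]
          -- Moving D fᵢ, turned back into fᵢ by s, from the front to slot i costs the sign (-1)ⁱ of
          -- the differential, so all n + 1 terms agree.
          have h4 := (exteriorPower.ιMulti ℂ (M := V) (n + 1)).map_insertNth i (f i)
            (i.removeNth f)
          rw [Fin.insertNth_self_removeNth] at h4
          rw [h3, h2, h1, smul_zero, zero_add, hs', wedgeSym, LinearMap.baseChange_tmul,
            wedge_ιMulti, h4, ← TensorProduct.tmul_smul]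
          rfl
        rw [Finset.sum_congr rfl fun i _ => hterm i, Finset.sum_const, Finset.card_univ,
          Fintype.card_fin, Nat.cast_smul_eq_nsmul]
      exact DFunLike.congr_fun key ω
    · simp only [Φ, LinearMap.add_apply, LinearMap.comp_apply, h2, map_add, symD_smul, smul_add]
      rw [← symD_wedgeSym D n (s w) x]
      abel
  -- With Φ u = h z, both Φ(Du) and Φ(z) equal DhDu, and Φ is injective.
  obtain ⟨u, hu⟩ := (hbij (n + 1)).2 (h (n + 1) z)
  have hsq : ∀ m (x : SymDeg V W (m + 2)), symD D m (symD D (m + 1) x) = 0 :=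
    fun m x => DFunLike.congr_fun (symD_comp D m) x
  refine ⟨u, (hbij n).1 ?_⟩
  simp only [Φ, LinearMap.add_apply, LinearMap.comp_apply] at hu ⊢
  rw [hsq, hz, map_zero, ← hu, map_add, hsq]
  simp

/-- The image of the differential in degree `0` is the kernel of `Sym W → Sym H`, if
`H` is the cokernel of `D`. -/
theorem exists_symD_eq_of_map_eq_zero {H : Type} [AddCommGroup H] [Module ℂ H]
    (D : V →ₗ[ℂ] W) (π : W →ₗ[ℂ] H) (hπ : Function.Surjective π)
    (hker : LinearMap.ker π = LinearMap.range D) (P : SymmetricAlgebra ℂ W)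
    (hP : SymmetricAlgebra.lift (SymmetricAlgebra.ι ℂ H ∘ₗ π) P = 0) :
    ∃ u : SymDeg V W 1, symD D 0 u = P ⊗ₜ exteriorPower.ιMulti ℂ 0 Fin.elim0 := by
  let ev : SymmetricAlgebra ℂ W →ₗ[SymmetricAlgebra ℂ W] SymDeg V W 0 :=
    LinearMap.toSpanSingleton _ _ (1 ⊗ₜ exteriorPower.ιMulti ℂ 0 Fin.elim0)
  -- I is the ideal of boundaries in degree 0. As it contains D(V), the quotient map by I factors
  -- through Sym π via a linear section t of π.
  let I : Ideal (SymmetricAlgebra ℂ W) := (LinearMap.range (symDLinear D 0)).comap ev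
  have hI : ∀ v, SymmetricAlgebra.ι ℂ W (D v) ∈ I := fun v =>
    ⟨wedgeSym V W 0 v (1 ⊗ₜ exteriorPower.ιMulti ℂ 0 Fin.elim0), by
      rw [symDLinear_apply, symD_wedgeSym_zero]; rfl⟩
  let q := Ideal.Quotient.mkₐ ℂ I
  obtain ⟨t, ht⟩ := π.exists_rightInverse_of_surjective (LinearMap.range_eq_top.mpr hπ)
  have key : (SymmetricAlgebra.lift (q.toLinearMap ∘ₗ SymmetricAlgebra.ι ℂ W ∘ₗ t)).comp
      (SymmetricAlgebra.lift (SymmetricAlgebra.ι ℂ H ∘ₗ π)) = q := by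
    refine SymmetricAlgebra.algHom_ext ?_
    ext w
    have hw : t (π w) - w ∈ LinearMap.range D := by
      rw [← hker, LinearMap.mem_ker, map_sub, sub_eq_zero]
      exact DFunLike.congr_fun ht (π w)
    obtain ⟨v, hv⟩ := hw
    have := hI v
    rw [hv, map_sub] at this
    simpa [q] using Ideal.Quotient.eq.mpr this
  have h2 : P ∈ I := by
    rw [← Ideal.Quotient.eq_zero_iff_mem]
    have := DFunLike.congr_fun key P
    rw [AlgHom.comp_apply, hP, map_zero] at this
    exact this.symm
  obtain ⟨u, hu⟩ := h2
  refine ⟨u, ?_⟩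
  rw [← symDLinear_apply, hu]
  simp [ev, TensorProduct.smul_tmul']

theorem map_eq_zero_of_symD_eq {H : Type} [AddCommGroup H] [Module ℂ H]
    (D : V →ₗ[ℂ] W) (π : W →ₗ[ℂ] H) (hker : LinearMap.range D ≤ LinearMap.ker π)
    (P : SymmetricAlgebra ℂ W) (u : SymDeg V W 1)
    (hu : symD D 0 u = P ⊗ₜ exteriorPower.ιMulti ℂ 0 Fin.elim0) :
    SymmetricAlgebra.lift (SymmetricAlgebra.ι ℂ H ∘ₗ π) P = 0 := by
  let F := SymmetricAlgebra.lift (SymmetricAlgebra.ι ℂ H ∘ₗ π)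
  let G : SymDeg V W 0 →ₗ[ℂ] SymmetricAlgebra ℂ H :=
    TensorProduct.lift (LinearMap.flip (LinearMap.comp
      ((LinearMap.lsmul ℂ (SymmetricAlgebra ℂ W →ₗ[ℂ] SymmetricAlgebra ℂ H)).flip
        F.toLinearMap) (exteriorPower.zeroEquiv ℂ V).toLinearMap))
  have hG : ∀ (Q : SymmetricAlgebra ℂ W) f,
      G (Q ⊗ₜ exteriorPower.ιMulti ℂ 0 f) = F Q := by
    intro Q f
    simp [G, exteriorPower.zeroEquiv_ιMulti]
  have key : G ∘ₗ symD D 0 = 0 := by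
    refine TensorProduct.ext ?_
    refine LinearMap.ext fun Q => exteriorPower.linearMap_ext ?_
    ext f
    have h0 : π (D (f 0)) = 0 := hker ⟨f 0, rfl⟩
    simp [symD_tmul, hG, F, h0]
  rw [← hG P Fin.elim0, ← hu]
  exact DFunLike.congr_fun key u

end KoszulExact

/-! ### Passage to the cohomology of the ℤ-indexed complex -/

theorem symChain_d {V W : Type} [AddCommGroup V] [Module ℂ V] [AddCommGroup W]
    [Module ℂ W] (D : V →ₗ[ℂ] W) (n : ℕ) :
    (symChain D).d (n + 1) n = ModuleCat.ofHom (symD D n) := by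
  simp [symChain]

open CategoryTheory in
theorem isZero_homology_symComplex {V W : Type} [AddCommGroup V] [Module ℂ V] [AddCommGroup W]
    [Module ℂ W] (D : V →ₗ[ℂ] W) (hD : Function.Injective D) (n : ℤ) (hn : n ≠ 0) :
    Limits.IsZero ((symComplex D).homology n) := by
  rw [← HomologicalComplex.exactAt_iff_isZero_homology]
  by_cases h : ∃ k : ℕ, ComplexShape.embeddingDownNat.f k = n
  · obtain ⟨k, hk⟩ := h
    rw [symComplex, HomologicalComplex.extend_exactAt_iff _ _ hk]
    obtain ⟨m, rfl⟩ : ∃ m, k = m + 1 := by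
      refine Nat.exists_eq_succ_of_ne_zero ?_
      rintro rfl
      exact hn (by simpa using hk.symm)
    rw [HomologicalComplex.exactAt_iff' _ (m + 2) (m + 1) m (by simp) (by simp),
      ShortComplex.moduleCat_exact_iff]
    intro z hz
    have h1 : (symChain D).d (m + 2) (m + 1) = ModuleCat.ofHom (symD D (m + 1)) :=
      symChain_d D (m + 1)
    have h2 : (symChain D).d (m + 1) m = ModuleCat.ofHom (symD D m) := symChain_d D m
    have hz' : (symChain D).d (m + 1) m z = 0 := hz
    rw [h2] at hz'
    obtain ⟨u, hu⟩ := exists_symD_eq_of_symD_eq_zero D hD m z hz'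
    refine ⟨u, ?_⟩
    change (symChain D).d (m + 2) (m + 1) u = z
    rw [h1]
    exact hu
  · exact HomologicalComplex.extend_exactAt _ _ _ fun j hj => h ⟨j, hj⟩

theorem exteriorPower_zero_eq_smul {V : Type} [AddCommGroup V] [Module ℂ V] (ω : ⋀[ℂ]^0 V) :
    ω = exteriorPower.zeroEquiv ℂ V ω • exteriorPower.ιMulti ℂ 0 Fin.elim0 := by
  apply (exteriorPower.zeroEquiv ℂ V).injective
  simp [exteriorPower.zeroEquiv_ιMulti]

open CategoryTheory in
theorem symDegZero_surjective {V W : Type} [AddCommGroup V] [Module ℂ V] [AddCommGroup W]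
    [Module ℂ W] (D : V →ₗ[ℂ] W) : Function.Surjective (symDegZero D) := by
  have h1 : Function.Surjective (HomologicalComplex.extendXIso (symChain D)
      ComplexShape.embeddingDownNat (i := 0) (i' := 0) rfl).inv :=
    (ModuleCat.epi_iff_surjective _).mp inferInstance
  intro x
  obtain ⟨y, rfl⟩ := h1 x
  have h2 : ∀ y : SymDeg V W 0, ∃ P : SymmetricAlgebra ℂ W,
      P ⊗ₜ[ℂ] exteriorPower.ιMulti ℂ 0 Fin.elim0 = y := by
    intro y
    induction y using TensorProduct.induction_on with
    | zero => exact ⟨0, TensorProduct.zero_tmul _ _⟩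
    | add a b ha hb =>
      obtain ⟨P, rfl⟩ := ha
      obtain ⟨Q, rfl⟩ := hb
      exact ⟨P + Q, TensorProduct.add_tmul _ _ _⟩
    | tmul P ω =>
      refine ⟨exteriorPower.zeroEquiv ℂ V ω • P, ?_⟩
      rw [TensorProduct.smul_tmul, ← exteriorPower_zero_eq_smul]
  obtain ⟨P, rfl⟩ := h2 y
  exact ⟨P, rfl⟩

open CategoryTheory in
theorem cohomClass_surjective {V W : Type} [AddCommGroup V] [Module ℂ V] [AddCommGroup W]
    [Module ℂ W] (D : V →ₗ[ℂ] W) : Function.Surjective (cohomClass D) := by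
  have h1 : Function.Surjective ((symComplex D).homologyπ 0) :=
    (ModuleCat.epi_iff_surjective _).mp inferInstance
  have h2 : Function.Injective ((symComplex D).iCycles 0) :=
    (ModuleCat.mono_iff_injective _).mp inferInstance
  intro x
  obtain ⟨y, rfl⟩ := h1 x
  obtain ⟨P, hP⟩ := symDegZero_surjective D ((symComplex D).iCycles 0 y)
  refine ⟨P, congrArg ((symComplex D).homologyπ 0) (h2 ?_)⟩
  rw [← hP]
  exact ConcreteCategory.congr_hom ((symComplex D).liftCycles_i (symDegZero D) 1 _ _) P

open CategoryTheory in
-- H⁰ embeds in the opcycles, the degree 0 part modulo boundaries; the rest is transport along the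
-- isomorphisms of `extend`.
theorem cohomClass_eq_zero_iff {V W : Type} [AddCommGroup V] [Module ℂ V] [AddCommGroup W]
    [Module ℂ W] (D : V →ₗ[ℂ] W) (P : SymmetricAlgebra ℂ W) :
    cohomClass D P = 0 ↔
      ∃ u : SymDeg V W 1, symD D 0 u = P ⊗ₜ exteriorPower.ιMulti ℂ 0 Fin.elim0 := by
  have h1 : Function.Injective ((symComplex D).homologyι 0) :=
    (ModuleCat.mono_iff_injective _).mp inferInstance
  have h2 : cohomClass D ≫ (symComplex D).homologyι 0 =
      symDegZero D ≫ (symComplex D).pOpcycles 0 := by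
    simp [cohomClass]
  have h3 : Function.Injective (HomologicalComplex.extendXIso (symChain D)
      ComplexShape.embeddingDownNat (i := 0) (i' := 0) rfl).inv :=
    (ModuleCat.mono_iff_injective _).mp inferInstance
  have h4 : Function.Surjective (HomologicalComplex.extendXIso (symChain D)
      ComplexShape.embeddingDownNat (i := 1) (i' := -1) rfl).hom :=
    (ModuleCat.epi_iff_surjective _).mp inferInstance
  have hd : (symChain D).d 1 0 = ModuleCat.ofHom (symD D 0) := symChain_d D 0
  have h5 : (symComplex D).d (-1) 0 = _ :=
    HomologicalComplex.extend_d_eq (symChain D) ComplexShape.embeddingDownNat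
      (i := 1) (j := 0) (i' := -1) (j' := 0) rfl rfl
  rw [hd] at h5
  rw [← map_eq_zero_iff _ h1, ← ModuleCat.comp_apply, h2, ModuleCat.comp_apply]
  have h6 := ((symComplex D).sc 0).moduleCat_pOpcycles_eq_zero_iff (symDegZero D P)
  refine h6.trans ?_
  have h7 : LinearMap.range ((symComplex D).sc 0).f.hom =
      LinearMap.range ((symComplex D).d (-1) 0).hom := by
    have : (ComplexShape.up ℤ).prev 0 = -1 := by simp
    change LinearMap.range ((symComplex D).d ((ComplexShape.up ℤ).prev 0) 0).hom = _
    rw [this]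
  rw [h7, h5]
  constructor
  · rintro ⟨x, hx⟩
    exact ⟨_, h3 hx⟩
  · rintro ⟨u, hu⟩
    obtain ⟨x, rfl⟩ := h4 u
    exact ⟨x, congrArg (HomologicalComplex.extendXIso (symChain D)
      ComplexShape.embeddingDownNat (i := 0) (i' := 0) rfl).inv hu⟩

theorem exists_homologyEquiv {V W H : Type} [AddCommGroup V] [Module ℂ V] [AddCommGroup W]
    [Module ℂ W] [AddCommGroup H] [Module ℂ H] (D : V →ₗ[ℂ] W) (π : W →ₗ[ℂ] H)
    (hπ : Function.Surjective π) (hker : LinearMap.ker π = LinearMap.range D) :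
    ∃ e : (symComplex D).homology 0 ≃ₗ[ℂ] SymmetricAlgebra ℂ H,
      ∀ P, e ((cohomClass D).hom P) =
        SymmetricAlgebra.lift (SymmetricAlgebra.ι ℂ H ∘ₗ π) P := by
  let F := (SymmetricAlgebra.lift (SymmetricAlgebra.ι ℂ H ∘ₗ π)).toLinearMap
  have hF : Function.Surjective F := by
    intro x
    induction x using SymmetricAlgebra.induction with
    | algebraMap r => exact ⟨algebraMap _ _ r, by simp [F]⟩
    | ι h =>
      obtain ⟨w, rfl⟩ := hπ h
      exact ⟨SymmetricAlgebra.ι ℂ W w, by simp [F]⟩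
    | mul a b ha hb =>
      obtain ⟨P, rfl⟩ := ha
      obtain ⟨Q, rfl⟩ := hb
      exact ⟨P * Q, by simp [F]⟩
    | add a b ha hb =>
      obtain ⟨P, rfl⟩ := ha
      obtain ⟨Q, rfl⟩ := hb
      exact ⟨P + Q, map_add _ _ _⟩
  have hk : LinearMap.ker (cohomClass D).hom = LinearMap.ker F := by
    ext P
    rw [LinearMap.mem_ker, LinearMap.mem_ker]
    refine (cohomClass_eq_zero_iff D P).trans ⟨fun ⟨u, hu⟩ => ?_, fun h => ?_⟩
    · exact map_eq_zero_of_symD_eq D π hker.ge P u hu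
    · exact exists_symD_eq_of_map_eq_zero D π hπ hker P h
  refine ⟨((cohomClass D).hom.quotKerEquivOfSurjective (cohomClass_surjective D)).symm ≪≫ₗ
    Submodule.quotEquivOfEq _ _ hk ≪≫ₗ F.quotKerEquivOfSurjective hF, fun P => ?_⟩
  have h1 : ((cohomClass D).hom.quotKerEquivOfSurjective (cohomClass_surjective D)).symm
      ((cohomClass D).hom P) = Submodule.Quotient.mk P := by
    rw [LinearEquiv.symm_apply_eq]
    rfl
  rw [LinearEquiv.trans_apply, LinearEquiv.trans_apply, h1]
  rfl

theorem exists_homologyEquiv_of_addCommMonoid {V W H : Type} [AddCommGroup V] [Module ℂ V]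
    [AddCommGroup W] [Module ℂ W] [AddCommMonoid H] [Module ℂ H] (D : V →ₗ[ℂ] W) (π : W →ₗ[ℂ] H)
    (hπ : Function.Surjective π) (hker : LinearMap.ker π = LinearMap.range D) :
    ∃ e : (symComplex D).homology 0 ≃ₗ[ℂ] SymmetricAlgebra ℂ H,
      ∀ P, e ((cohomClass D).hom P) =
        SymmetricAlgebra.lift (SymmetricAlgebra.ι ℂ H ∘ₗ π) P := by
  -- Negation is added on top of the given additive monoid, so the symmetric algebra is unchanged.
  let _ : AddCommGroup H := Module.addCommMonoidToAddCommGroup ℂ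
  exact exists_homologyEquiv D π hπ hker

open scoped ContDiff FourierTransform

/-! ### Division by powers of |x|²: regularity and decay -/

section Division

variable {E : Type} [NormedAddCommGroup E] [InnerProductSpace ℝ E]

/-- `R` is smooth and its derivatives of order less than `n` vanish at the origin. -/
def VanishesToOrder {F : Type} [NormedAddCommGroup F] [NormedSpace ℝ F] (n : ℕ) (R : E → F) :
    Prop :=
  ContDiff ℝ ∞ R ∧ ∀ i < n, iteratedFDeriv ℝ i R 0 = 0

variable {F G H : Type} [NormedAddCommGroup F] [NormedSpace ℝ F] [NormedAddCommGroup G]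
  [NormedSpace ℝ G] [NormedAddCommGroup H] [NormedSpace ℝ H]

theorem VanishesToOrder.mono {n m : ℕ} {R : E → F} (h : VanishesToOrder n R) (hm : m ≤ n) :
    VanishesToOrder m R := ⟨h.1, fun i hi => h.2 i (hi.trans_le hm)⟩

theorem VanishesToOrder.fderiv_right {n : ℕ} {R : E → F} (h : VanishesToOrder (n + 1) R) :
    VanishesToOrder n (fderiv ℝ R) := by
  refine ⟨h.1.fderiv_right le_rfl, fun i hi => ?_⟩
  rw [← norm_eq_zero, norm_iteratedFDeriv_fderiv, h.2 _ (Nat.succ_lt_succ hi), norm_zero]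

theorem VanishesToOrder.bilinear {n : ℕ} {f : E → F} {g : E → G} (B : F →L[ℝ] G →L[ℝ] H)
    (hf : ContDiff ℝ ∞ f) (hg : VanishesToOrder n g) :
    VanishesToOrder n fun x => B (f x) (g x) := by
  refine ⟨B.isBoundedBilinearMap.contDiff.comp (hf.prodMk hg.1), fun i hi => ?_⟩
  have := B.norm_iteratedFDeriv_le_of_bilinear hf hg.1 (0 : E) (n := i) (mod_cast le_top)
  rw [← norm_eq_zero]
  refine le_antisymm (this.trans_eq ?_) (norm_nonneg _)
  rw [Finset.sum_eq_zero, mul_zero]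
  intro j _
  rw [hg.2 (i - j) (by omega), norm_zero, mul_zero]

theorem VanishesToOrder.sub {n : ℕ} {f g : E → F} (hf : VanishesToOrder n f)
    (hg : VanishesToOrder n g) : VanishesToOrder n (f - g) := by
  refine ⟨hf.1.sub hg.1, fun i hi => ?_⟩
  rw [iteratedFDeriv_sub_apply ((hf.1.of_le (mod_cast le_top)).contDiffAt)
    ((hg.1.of_le (mod_cast le_top)).contDiffAt), hf.2 i hi, hg.2 i hi, sub_zero]

theorem VanishesToOrder.apply_zero {n : ℕ} {R : E → F} (h : VanishesToOrder n R) (hn : n ≠ 0) :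
    R 0 = 0 := by
  have := h.2 0 (Nat.pos_of_ne_zero hn)
  rwa [← norm_eq_zero, norm_iteratedFDeriv_zero, norm_eq_zero] at this

theorem VanishesToOrder.exists_norm_le [ProperSpace E] {n : ℕ} {R : E → F}
    (h : VanishesToOrder n R) :
    ∃ C, 0 ≤ C ∧ ∀ x, ‖x‖ ≤ 1 → ‖R x‖ ≤ C * ‖x‖ ^ n := by
  induction n generalizing F with
  | zero =>
    obtain ⟨C, hC⟩ := (isCompact_closedBall (0 : E) 1).exists_bound_of_continuousOn
      h.1.continuous.continuousOn
    refine ⟨C, (norm_nonneg _).trans (hC 0 (by simp)), fun x hx => ?_⟩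
    simpa using hC x (by simpa using hx)
  | succ n ih =>
    obtain ⟨C, hC0, hC⟩ := ih h.fderiv_right
    refine ⟨C, hC0, fun x hx => ?_⟩
    -- Mean value inequality on the ball of radius ‖x‖, where the derivative is at most C‖x‖ⁿ.
    have := (convex_closedBall (0 : E) ‖x‖).norm_image_sub_le_of_norm_fderiv_le (𝕜 := ℝ) (f := R)
      (C := C * ‖x‖ ^ n) (x := 0) (y := x)
      (fun y _ => (h.1.differentiable (by simp)) y) (fun y hy => ?_) (by simp) (by simp)
    · rw [h.apply_zero n.succ_ne_zero, sub_zero, sub_zero] at this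
      rwa [pow_succ, ← mul_assoc]
    · rw [mem_closedBall_zero_iff] at hy
      refine (hC y (hy.trans hx)).trans ?_
      gcongr

/-- The quotient `R / |x|²ᵃ`. -/
def divNormSq (a : ℕ) (R : E → F) (x : E) : F := (‖x‖ ^ 2) ^ (-(a : ℤ)) • R x

theorem VanishesToOrder.exists_norm_divNormSq_le [ProperSpace E] {n a k : ℕ} {R : E → F}
    (h : VanishesToOrder n R) (hk : k ≠ 0) (hn : 2 * a + k ≤ n) :
    ∃ C, 0 ≤ C ∧ ∀ x, ‖x‖ ≤ 1 → ‖divNormSq a R x‖ ≤ C * ‖x‖ ^ k := by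
  obtain ⟨C, hC0, hC⟩ := (h.mono hn).exists_norm_le
  refine ⟨C, hC0, fun x hx => ?_⟩
  rcases eq_or_ne x 0 with rfl | hx0
  · rw [divNormSq, h.apply_zero (by omega), smul_zero, norm_zero]
    positivity
  · have hx1 : (‖x‖ ^ 2) ^ a ≠ 0 := by positivity
    rw [divNormSq, norm_smul, zpow_neg, zpow_natCast, norm_inv, Real.norm_of_nonneg (by positivity),
      inv_mul_le_iff₀ (by positivity)]
    refine (hC x hx).trans_eq ?_
    rw [pow_add, pow_mul]
    ring

theorem hasFDerivAt_divNormSq (a : ℕ) {R : E → F} (hR : Differentiable ℝ R) {x : E}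
    (hx : x ≠ 0) :
    HasFDerivAt (divNormSq a R) (divNormSq (a + 1) (fun x => ‖x‖ ^ 2 • fderiv ℝ R x -
      (2 * a : ℝ) • (innerSL ℝ x).smulRight (R x)) x) x := by
  have h0 : ‖x‖ ^ 2 ≠ 0 := by positivity
  have h1 : HasFDerivAt (fun y : E => ‖y‖ ^ 2) (2 • innerSL ℝ x) x :=
    (hasStrictFDerivAt_norm_sq x).hasFDerivAt
  have h2 := (hasDerivAt_zpow (-(a : ℤ)) (‖x‖ ^ 2) (Or.inl h0)).comp_hasFDerivAt x h1
  have h3 := h2.smul (hR x).hasFDerivAt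
  refine h3.congr_fderiv ?_
  ext v
  have h4 : (‖x‖ ^ 2) ^ (-(a : ℤ)) = (‖x‖ ^ 2) ^ (-(a : ℤ) - 1) * ‖x‖ ^ 2 := by
    rw [← zpow_add_one₀ h0, sub_add_cancel]
  have h5 : (-((a + 1 : ℕ) : ℤ)) = -(a : ℤ) - 1 := by push_cast; ring
  simp only [divNormSq, h5, Function.comp_apply, add_apply,
    smul_apply, sub_apply,
    ContinuousLinearMap.smulRight_apply, smul_sub, smul_smul, h4]
  simp only [nsmul_eq_mul, smul_eq_mul, Int.cast_neg, Int.cast_natCast, Nat.cast_ofNat]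
  module

/-- Differentiating R / |x|²ᵃ raises a by one, and the new numerator S is only claimed to vanish to
order n - 1. Each derivative thus costs 2 + 1 = 3 orders; the final 1 gives continuity at 0. -/
theorem VanishesToOrder.contDiff_divNormSq [ProperSpace E] (m : ℕ) {a n : ℕ} {R : E → F}
    (h : VanishesToOrder n R) (hn : 2 * a + 3 * m + 1 ≤ n) : ContDiff ℝ m (divNormSq a R) := by
  induction m generalizing F a n with
  | zero =>
    rw [Nat.cast_zero, contDiff_zero, continuous_iff_continuousAt]
    intro x
    rcases eq_or_ne x 0 with rfl | hx
    · obtain ⟨C, -, hC⟩ := h.exists_norm_divNormSq_le one_ne_zero (a := a) (by omega)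
      have h0 : divNormSq a R 0 = 0 := by
        rw [divNormSq, h.apply_zero (by omega), smul_zero]
      rw [ContinuousAt, h0]
      have h1 : Filter.Tendsto (fun x : E => C * ‖x‖ ^ 1) (nhds 0) (nhds 0) := by
        have : Continuous fun x : E => C * ‖x‖ ^ 1 := by fun_prop
        simpa using this.tendsto 0
      refine squeeze_zero_norm' ?_ h1
      filter_upwards [Metric.closedBall_mem_nhds (0 : E) one_pos] with x hx
      exact hC x (by simpa using hx)
    · exact (hasFDerivAt_divNormSq a (h.1.differentiable (by simp)) hx).continuousAt
  | succ m ih =>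
    have hdiff : Differentiable ℝ R := h.1.differentiable (by simp)
    obtain ⟨n, rfl⟩ : ∃ k, n = k + 1 := ⟨n - 1, by omega⟩
    set S : E → E →L[ℝ] F := fun x => ‖x‖ ^ 2 • fderiv ℝ R x -
      (2 * a : ℝ) • (innerSL ℝ x).smulRight (R x) with hS
    have hSv : VanishesToOrder n S := by
      refine VanishesToOrder.sub ?_ ?_
      · exact h.fderiv_right.bilinear (ContinuousLinearMap.lsmul ℝ ℝ) (contDiff_norm_sq ℝ)
      · exact VanishesToOrder.bilinear (ContinuousLinearMap.lsmul ℝ ℝ)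
          (f := fun _ => (2 * a : ℝ)) contDiff_const
          ((h.mono n.le_succ).bilinear (ContinuousLinearMap.smulRightL ℝ E F)
            (innerSL ℝ).contDiff)
    have hder : ∀ x, HasFDerivAt (divNormSq a R) (divNormSq (a + 1) S x) x := by
      intro x
      rcases eq_or_ne x 0 with rfl | hx
      · obtain ⟨C, -, hC⟩ := h.exists_norm_divNormSq_le two_ne_zero (a := a) (by omega)
        have h0 : divNormSq a R 0 = 0 := by
          rw [divNormSq, h.apply_zero (by omega), smul_zero]
        have h0' : divNormSq (a + 1) S 0 = 0 := by
          rw [divNormSq, hSv.apply_zero (by omega), smul_zero]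
        rw [h0', hasFDerivAt_iff_isLittleO_nhds_zero]
        simp only [zero_add, h0, sub_zero, zero_apply]
        -- Away from 0 the quotient rule applies; at 0 a quotient of size O(|x|²) has derivative
        -- zero.
        have h1 : (fun x => divNormSq a R x) =O[nhds 0] fun x : E => ‖x‖ ^ 2 := by
          refine Asymptotics.IsBigO.of_bound C ?_
          filter_upwards [Metric.closedBall_mem_nhds (0 : E) one_pos] with x hx
          rw [norm_pow, norm_norm]
          exact hC x (by simpa using hx)
        exact h1.trans_isLittleO (Asymptotics.isLittleO_norm_pow_id one_lt_two)
      · exact hasFDerivAt_divNormSq a hdiff hx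
    rw [Nat.cast_succ, contDiff_succ_iff_fderiv]
    refine ⟨fun x => (hder x).differentiableAt, by simp, ?_⟩
    have : fderiv ℝ (divNormSq a R) = divNormSq (a + 1) S := funext fun x => (hder x).fderiv
    rw [this]
    exact ih hSv (by omega)

/-- Near 0 continuity suffices, and outside the unit ball |x|²ᵃ ≥ 1, so w is bounded by g. The
induction passes to the derivative of w, at the price of a + 1. -/
theorem exists_norm_pow_mul_iteratedFDeriv_le [ProperSpace E] (j : ℕ) (a : ℕ) {w : E → F}
    (hw : ContDiff ℝ ∞ w) (g : 𝓢(E, F)) (hg : ∀ x, g x = (‖x‖ ^ 2) ^ a • w x) (k : ℕ) :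
    ∃ C, ∀ x, ‖x‖ ^ k * ‖iteratedFDeriv ℝ j w x‖ ≤ C := by
  induction j generalizing F a with
  | zero =>
    obtain ⟨C₁, hC₁⟩ := (isCompact_closedBall (0 : E) 1).exists_bound_of_continuousOn
      hw.continuous.continuousOn
    obtain ⟨C₂, hC₂⟩ := g.decay k 0
    refine ⟨max C₁ C₂, fun x => ?_⟩
    rw [norm_iteratedFDeriv_zero]
    rcases le_total ‖x‖ 1 with hx | hx
    · refine le_max_of_le_left (le_trans ?_ (hC₁ x (by simpa using hx)))
      exact mul_le_of_le_one_left (norm_nonneg _) (pow_le_one₀ (norm_nonneg _) hx)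
    · refine le_max_of_le_right (le_trans ?_ (hC₂.2 x))
      rw [norm_iteratedFDeriv_zero, hg, norm_smul]
      gcongr
      refine le_mul_of_one_le_left (norm_nonneg _) ?_
      rw [Real.norm_of_nonneg (by positivity)]
      exact one_le_pow₀ (one_le_pow₀ hx)
  | succ j ih =>
    have hsq : (fun x : E => ‖x‖ ^ 2).HasTemperateGrowth := by fun_prop
    -- The product rule gives |x|²⁽ᵃ⁺¹⁾ dw = |x|² dg - 2a ⟨x, ·⟩ g, again a Schwartz function.
    let g' : 𝓢(E, E →L[ℝ] F) :=
      SchwartzMap.smulLeftCLM (E →L[ℝ] F) (fun x : E => ‖x‖ ^ 2) (SchwartzMap.fderivCLM ℝ E F g) -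
        (2 * a : ℝ) • SchwartzMap.smulRightCLM ℝ F (innerSL ℝ) g
    have hwd : ∀ x, HasFDerivAt w (fderiv ℝ w x) x := fun x =>
      (hw.differentiable (by simp) x).hasFDerivAt
    obtain ⟨C, hC⟩ := ih (a + 1) (hw.fderiv_right (m := ∞) le_rfl) g' (fun x => by
      have h1 : HasFDerivAt (fun y : E => ‖y‖ ^ 2) (2 • innerSL ℝ x) x :=
        (hasStrictFDerivAt_norm_sq x).hasFDerivAt
      have h2 := (h1.pow a).smul (hwd x)
      have h3 : (g : E → F) = fun x => (‖x‖ ^ 2) ^ a • w x := funext hg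
      have h4 := h2.fderiv
      change fderiv ℝ (fun x => (‖x‖ ^ 2) ^ a • w x) x = _ at h4
      rw [← h3] at h4
      ext v
      simp only [g', sub_apply, smul_apply, SchwartzMap.smulLeftCLM_apply_apply hsq,
        SchwartzMap.fderivCLM_apply, SchwartzMap.smulRightCLM_apply_apply, h4, hg]
      simp only [add_apply,
        smul_apply,
        ContinuousLinearMap.smulRight_apply, smul_add, smul_smul, nsmul_eq_mul, smul_eq_mul,
        Nat.cast_ofNat]
      cases a with
      | zero => simp
      | succ b =>
        rw [Nat.add_sub_cancel]
        module)
    refine ⟨C, fun x => ?_⟩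
    rw [← norm_iteratedFDeriv_fderiv]
    exact hC x

end Division

/-! ### Polynomial moments of Schwartz functions -/

section Moments

variable {d : ℕ}

theorem polyFun_map_conj (p : MvPolynomial (Fin d) ℂ) (x : EuclideanSpace ℝ (Fin d)) :
    polyFun (MvPolynomial.map (starRingEnd ℂ) p) x = conj (polyFun p x) := by
  rw [polyFun, polyFun, MvPolynomial.eval_map, MvPolynomial.eval, MvPolynomial.coe_eval₂Hom,
    ← MvPolynomial.coe_eval₂Hom, MvPolynomial.hom_eval₂]
  simp

theorem map_conj_map_conj (p : MvPolynomial (Fin d) ℂ) :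
    MvPolynomial.map (starRingEnd ℂ) (MvPolynomial.map (starRingEnd ℂ) p) = p := by
  ext m
  simp [MvPolynomial.coeff_map]

theorem polyLaplacian_apply (p : MvPolynomial (Fin d) ℂ) :
    polyLaplacian d p = ∑ i, MvPolynomial.pderiv i (MvPolynomial.pderiv i p) := by
  simp [polyLaplacian]

theorem polyLaplacian_map_conj (p : MvPolynomial (Fin d) ℂ) :
    polyLaplacian d (MvPolynomial.map (starRingEnd ℂ) p) =
      MvPolynomial.map (starRingEnd ℂ) (polyLaplacian d p) := by
  simp [polyLaplacian_apply, MvPolynomial.pderiv_map]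

theorem map_conj_mem_harmonicPoly {k : ℕ} {p : MvPolynomial (Fin d) ℂ}
    (hp : p ∈ harmonicPoly d k) : MvPolynomial.map (starRingEnd ℂ) p ∈ harmonicPoly d k := by
  refine ⟨MvPolynomial.IsHomogeneous.map hp.1 _, ?_⟩
  have h : polyLaplacian d p = 0 := hp.2
  change polyLaplacian d _ = 0
  rw [polyLaplacian_map_conj, h, map_zero]

theorem homogeneousComponent_mem_harmonicPoly {p : MvPolynomial (Fin d) ℂ}
    (hp : polyLaplacian d p = 0) (k : ℕ) :
    MvPolynomial.homogeneousComponent k p ∈ harmonicPoly d k := by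
  refine ⟨MvPolynomial.homogeneousComponent_mem k p, ?_⟩
  change polyLaplacian d _ = 0
  ext m
  have h := congrArg (MvPolynomial.coeff m) hp
  rw [polyLaplacian_apply] at h ⊢
  simp only [MvPolynomial.coeff_sum, MvPolynomial.coeff_pderiv, MvPolynomial.coeff_zero,
    MvPolynomial.coeff_homogeneousComponent, map_add, Finsupp.degree_single] at h ⊢
  split_ifs
  · exact h
  · simp

/-- The moment `∫ p(x) f(x) dx`. -/
def moment : MvPolynomial (Fin d) ℂ →ₗ[ℂ] Sch d →ₗ[ℂ] ℂ where
  toFun p := pairing (MvPolynomial.map (starRingEnd ℂ) p)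
  map_add' p q := by
    ext f
    simp only [pairing, LinearMap.coe_mk, AddHom.coe_mk, LinearMap.add_apply]
    rw [← MeasureTheory.integral_add (integrable_pairing _ f) (integrable_pairing _ f)]
    simp [polyFun, add_mul]
  map_smul' c p := by
    ext f
    simp only [pairing, LinearMap.coe_mk, AddHom.coe_mk, LinearMap.smul_apply, smul_eq_mul,
      RingHom.id_apply]
    rw [← MeasureTheory.integral_const_mul]
    simp [polyFun, MvPolynomial.smul_eq_C_mul, mul_assoc]

theorem moment_apply (p : MvPolynomial (Fin d) ℂ) (f : Sch d) :
    moment p f = ∫ x, polyFun p x * f x := by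
  simp [moment, pairing, polyFun_map_conj]

theorem pairing_eq_moment (p : MvPolynomial (Fin d) ℂ) :
    pairing p = moment (MvPolynomial.map (starRingEnd ℂ) p) := by
  simp [moment, map_conj_map_conj]

theorem integrable_polyFun_mul (p : MvPolynomial (Fin d) ℂ) (f : Sch d) :
    MeasureTheory.Integrable fun x => polyFun p x * f x := by
  simpa [polyFun_map_conj] using integrable_pairing (MvPolynomial.map (starRingEnd ℂ) p) f

theorem polyFun_hasTemperateGrowth (p : MvPolynomial (Fin d) ℂ) :
    (polyFun p).HasTemperateGrowth := by
  have h := conj_polyFun_hasTemperateGrowth (MvPolynomial.map (starRingEnd ℂ) p)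
  simpa only [polyFun_map_conj, Complex.conj_conj] using h

theorem hasFDerivAt_polyFun (p : MvPolynomial (Fin d) ℂ) (x : EuclideanSpace ℝ (Fin d)) :
    HasFDerivAt (polyFun p) (∑ i, polyFun (MvPolynomial.pderiv i p) x •
      Complex.ofRealCLM.comp (EuclideanSpace.proj (𝕜 := ℝ) i)) x := by
  induction p using MvPolynomial.induction_on with
  | C a =>
    have h : polyFun (d := d) (MvPolynomial.C a) = fun _ => a := by
      funext x; simp [polyFun]
    rw [h]
    refine (hasFDerivAt_const a x).congr_fderiv ?_
    ext v
    simp [polyFun]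
  | add p q hp hq =>
    have h : polyFun (p + q) = polyFun p + polyFun q := by
      funext x; simp [polyFun]
    rw [h]
    refine (hp.add hq).congr_fderiv ?_
    ext v
    simp [polyFun, add_mul, Finset.sum_add_distrib]
  | mul_X p j hp =>
    have h : polyFun (p * MvPolynomial.X j) =
        fun x => polyFun p x *
          (Complex.ofRealCLM.comp (EuclideanSpace.proj (𝕜 := ℝ) j)) x := by
      funext x; simp [polyFun]
    rw [h]
    refine (hp.mul (Complex.ofRealCLM.comp
      (EuclideanSpace.proj (𝕜 := ℝ) j)).hasFDerivAt).congr_fderiv ?_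
    ext v
    simp only [polyFun, Derivation.leibniz, MvPolynomial.pderiv_X, Pi.single_apply, smul_eq_mul,
      map_add, map_mul, MvPolynomial.eval_X, add_apply, smul_apply, sum_apply,
      Finset.mul_sum]
    simp [apply_ite, add_mul, Finset.sum_add_distrib, mul_assoc]

theorem moment_lineDerivOp (p : MvPolynomial (Fin d) ℂ) (f : Sch d) (i : Fin d) :
    moment p (LineDeriv.lineDerivOp (EuclideanSpace.basisFun (Fin d) ℝ i) f) =
      -moment (MvPolynomial.pderiv i p) f := by
  have h1 : ∀ x, fderiv ℝ (polyFun p) x (EuclideanSpace.basisFun (Fin d) ℝ i) =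
      polyFun (MvPolynomial.pderiv i p) x := by
    intro x
    rw [(hasFDerivAt_polyFun p x).fderiv]
    simp [PiLp.single_apply, apply_ite Complex.ofReal]
  have h3 : MeasureTheory.Integrable fun x =>
      polyFun p x * fderiv ℝ f x (EuclideanSpace.basisFun (Fin d) ℝ i) :=
    integrable_polyFun_mul p (LineDeriv.lineDerivOp (EuclideanSpace.basisFun (Fin d) ℝ i) f)
  have h2 := integral_mul_fderiv_eq_neg_fderiv_mul_of_integrable
    (μ := MeasureTheory.volume) (f := polyFun p) (g := f)
    (v := EuclideanSpace.basisFun (Fin d) ℝ i)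
    (by simpa only [h1] using integrable_polyFun_mul _ f)
    h3 (integrable_polyFun_mul p f) (fun x _ => (hasFDerivAt_polyFun p x).differentiableAt)
    (fun x _ => f.differentiableAt)
  simp only [h1] at h2
  rw [moment_apply, moment_apply, ← h2]
  rfl

theorem moment_laplacian (p : MvPolynomial (Fin d) ℂ) (f : Sch d) :
    moment p (Δ f) = moment (polyLaplacian d p) f := by
  rw [SchwartzMap.laplacian_eq_sum (EuclideanSpace.basisFun (Fin d) ℝ), map_sum,
    polyLaplacian_apply, map_sum, LinearMap.sum_apply]
  refine Finset.sum_congr rfl fun i _ => ?_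
  rw [moment_lineDerivOp, moment_lineDerivOp, neg_neg]

/-- Testing against compactly supported smooth functions shows that p vanishes on ℝᵈ, and a
polynomial vanishing on a product of infinite sets is zero. -/
theorem moment_injective : Function.Injective (moment (d := d)) := by
  rw [← LinearMap.ker_eq_bot, LinearMap.ker_eq_bot']
  intro p hp
  have hc : Continuous (polyFun p) := continuous_iff_continuousAt.mpr fun x =>
    (hasFDerivAt_polyFun p x).continuousAt
  have h1 : ∀ᵐ x : EuclideanSpace ℝ (Fin d), polyFun p x = 0 := by
    refine ae_eq_zero_of_integral_contDiff_smul_eq_zero hc.locallyIntegrable fun g hg hgs => ?_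
    have hg' : HasCompactSupport fun x => (g x : ℂ) := hgs.comp_left (g := Complex.ofReal) rfl
    have := DFunLike.congr_fun hp
      (hg'.toSchwartzMap (Complex.ofRealCLM.contDiff.comp hg))
    rw [moment_apply] at this
    change ∫ x, polyFun p x * (g x : ℂ) = 0 at this
    simpa [mul_comm] using this
  have h2 : polyFun p = 0 :=
    (hc.ae_eq_iff_eq MeasureTheory.volume continuous_zero).mp h1
  refine MvPolynomial.funext_set (fun _ => Set.range ((↑) : ℝ → ℂ))
    (fun _ => Set.infinite_range_of_injective Complex.ofReal_injective) fun x hx => ?_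
  choose y hy using fun i => hx i trivial
  have := congrFun h2 (WithLp.toLp 2 y)
  simp only [polyFun, hy] at this
  simpa using this

/-- A Schwartz function all of whose moments against harmonic polynomials vanish has, up to any
finite order, the moments of the Laplacian of a Schwartz function. -/
theorem exists_moment_eq_moment_laplacian (f : Sch d)
    (hf : ∀ k, ∀ p ∈ harmonicPoly d k, moment p f = 0) {ι : Type} [Fintype ι]
    (q : ι → MvPolynomial (Fin d) ℂ) :
    ∃ g : Sch d, ∀ i, moment (q i) f = moment (q i) (Δ g) := by
  classical
  let M : Sch d →ₗ[ℂ] ι → ℂ := LinearMap.pi fun i => moment (q i)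
  let L : Sch d →ₗ[ℂ] Sch d :=
    (LineDeriv.laplacianCLM ℂ (EuclideanSpace ℝ (Fin d)) (Sch d)).toLinearMap
  by_contra! hcon
  have hnot : M f ∉ LinearMap.range (M ∘ₗ L) := by
    rintro ⟨g, hg⟩
    obtain ⟨i, hi⟩ := hcon g
    refine hi ?_
    have := congrFun hg i
    rw [← SchwartzMap.laplacianCLM_eq ℂ]
    exact this.symm
  -- Separate M f from the moment vectors of Laplacians. The separating functional is the moment
  -- against a combination p of the qᵢ; killing all Laplacians makes p harmonic, so it kills f too.
  obtain ⟨c, hc, hcr⟩ := Submodule.exists_le_ker_of_notMem hnot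
  set p := ∑ i, c (fun j => if i = j then 1 else 0) • q i with hp
  have hM : ∀ g, c (M g) = moment p g := by
    intro g
    rw [hp, LinearMap.pi_apply_eq_sum_univ c]
    simp [M, mul_comm]
  have hlap : polyLaplacian d p = 0 := by
    apply moment_injective
    ext g
    rw [← moment_laplacian, ← hM, map_zero, LinearMap.zero_apply]
    have := hcr ⟨g, rfl⟩
    rwa [LinearMap.mem_ker, LinearMap.comp_apply, ContinuousLinearMap.coe_coe,
      SchwartzMap.laplacianCLM_eq] at this
  refine hc ?_
  rw [hM, ← MvPolynomial.sum_homogeneousComponent p, map_sum, LinearMap.sum_apply]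
  exact Finset.sum_eq_zero fun k _ => hf k _ (homogeneousComponent_mem_harmonicPoly hlap k)

end Moments

/-! ### Solving Δg = f on the Fourier side -/

section Fourier

variable {d : ℕ}

theorem iteratedLineDerivOp_fourier (h : Sch d) (i : ℕ) (m : Fin i → Fin d) :
    LineDeriv.iteratedLineDerivOp (fun j => EuclideanSpace.basisFun (Fin d) ℝ (m j)) (𝓕 h) =
      (-(2 * Real.pi * Complex.I)) ^ i • 𝓕 (SchwartzMap.smulLeftCLM ℂ
        (polyFun (∏ j, MvPolynomial.X (m j))) h) := by
  induction i with
  | zero =>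
    have : polyFun (d := d) (∏ j, MvPolynomial.X (m j)) = fun _ => 1 := by
      funext x
      simp [polyFun]
    rw [this, SchwartzMap.smulLeftCLM_const]
    simp
  | succ i ih =>
    rw [LineDeriv.iteratedLineDerivOp_succ_left]
    have h1 := ih (Fin.tail m)
    simp only [Fin.tail_def] at h1 ⊢
    rw [h1, LineDeriv.lineDerivOp_smul, SchwartzMap.lineDerivOp_fourier_eq, pow_succ, mul_smul]
    congr 1
    rw [← FourierTransform.fourier_smul]
    congr 2
    ext x
    have h2 : (fun x : EuclideanSpace ℝ (Fin d) =>
        inner ℝ x (EuclideanSpace.basisFun (Fin d) ℝ (m 0))).HasTemperateGrowth := by fun_prop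
    rw [SchwartzMap.smulLeftCLM_apply_apply h2,
      SchwartzMap.smulLeftCLM_apply_apply (polyFun_hasTemperateGrowth _),
      SchwartzMap.smulLeftCLM_apply_apply (polyFun_hasTemperateGrowth _), Fin.prod_univ_succ]
    simp [polyFun, EuclideanSpace.inner_single_right, mul_assoc]

/-- Up to powers of -2πi, the derivatives of 𝓕h at 0 are the monomial moments of h. -/
theorem vanishesToOrder_fourier (n : ℕ) (h : Sch d)
    (hm : ∀ i < n, ∀ m : Fin i → Fin d, moment (∏ j, MvPolynomial.X (m j)) h = 0) :
    VanishesToOrder n (𝓕 h : Sch d) := by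
  refine ⟨(𝓕 h).smooth ⊤, fun i hi => ?_⟩
  apply ContinuousMultilinearMap.toMultilinearMap_injective
  refine Module.Basis.ext_multilinear
    (fun _ => (EuclideanSpace.basisFun (Fin d) ℝ).toBasis) fun m => ?_
  have h1 := congrArg (fun u : Sch d => u 0) (iteratedLineDerivOp_fourier h i m)
  simp only [SchwartzMap.iteratedLineDerivOp_eq_iteratedFDeriv, smul_apply] at h1
  have h2 : 𝓕 (SchwartzMap.smulLeftCLM ℂ (polyFun (∏ j, MvPolynomial.X (m j))) h) 0 =
      moment (∏ j, MvPolynomial.X (m j)) h := by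
    rw [moment_apply, SchwartzMap.fourier_coe, Real.fourier_eq]
    simp [SchwartzMap.smulLeftCLM_apply_apply (polyFun_hasTemperateGrowth _)]
  rw [h2, hm i hi, smul_zero] at h1
  simpa using h1

theorem fourier_laplacian_apply (g : Sch d) (ξ : EuclideanSpace ℝ (Fin d)) :
    𝓕 (Δ g) ξ = -(2 * Real.pi) ^ 2 • ‖ξ‖ ^ 2 • 𝓕 g ξ := by
  have h : (fun x : EuclideanSpace ℝ (Fin d) => ‖x‖ ^ 2).HasTemperateGrowth := by fun_prop
  rw [SchwartzMap.laplacian_eq_fourierMultiplierCLM, FourierTransform.fourier_smul,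
    SchwartzMap.fourierMultiplierCLM_apply, FourierTransform.fourier_fourierInv_eq, smul_apply]
  congr 1
  exact SchwartzMap.smulLeftCLM_apply_apply h _ ξ

theorem eq_of_continuous_of_norm_sq_smul_eq (hd : 2 ≤ d) {u v : EuclideanSpace ℝ (Fin d) → ℂ}
    (hu : Continuous u) (hv : Continuous v) (h : ∀ ξ, ‖ξ‖ ^ 2 • u ξ = ‖ξ‖ ^ 2 • v ξ) : u = v := by
  have : Nonempty (Fin d) := ⟨⟨0, by omega⟩⟩
  have hdense : Dense ({0}ᶜ : Set (EuclideanSpace ℝ (Fin d))) := dense_compl_singleton 0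
  refine Continuous.ext_on hdense hu hv fun ξ hξ => ?_
  have h0 : ‖ξ‖ ^ 2 ≠ 0 := pow_ne_zero 2 (norm_ne_zero_iff.mpr hξ)
  exact smul_right_injective ℂ h0 (h ξ)

theorem laplacian_injective (hd : 2 ≤ d) {g : Sch d} (hg : Δ g = 0) : g = 0 := by
  have h1 : (𝓕 g : Sch d) = 0 := by
    apply DFunLike.coe_injective
    refine eq_of_continuous_of_norm_sq_smul_eq hd (𝓕 g).continuous continuous_const fun ξ => ?_
    have h2 := fourier_laplacian_apply g ξ
    rw [hg, FourierTransform.fourier_zero] at h2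
    have h3 : -(2 * Real.pi) ^ 2 ≠ 0 := neg_ne_zero.mpr (pow_ne_zero 2 Real.two_pi_pos.ne')
    have h4 := (smul_eq_zero.mp h2.symm).resolve_left h3
    rw [h4]
    exact (smul_zero _).symm
  rw [← FourierTransform.fourierInv_fourier_eq g (F := Sch d), h1, FourierTransform.fourierInv_zero]

theorem exists_contDiff_norm_sq_smul_eq (f : Sch d)
    (hf : ∀ k, ∀ p ∈ harmonicPoly d k, moment p f = 0) (m : ℕ) :
    ∃ w : EuclideanSpace ℝ (Fin d) → ℂ, ContDiff ℝ m w ∧ ∀ ξ, 𝓕 f ξ = ‖ξ‖ ^ 2 • w ξ := by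
  -- The vanishing order that `contDiff_divNormSq` requires for a C^m quotient when a = 1.
  set n := 2 * 1 + 3 * m + 1 with hn
  obtain ⟨g, hg⟩ := exists_moment_eq_moment_laplacian f hf
    fun s : (i : Fin n) × (Fin i → Fin d) =>
      (∏ j, MvPolynomial.X (s.2 j) : MvPolynomial (Fin d) ℂ)
  have hv : VanishesToOrder n (𝓕 (f - Δ g) : Sch d) := by
    refine vanishesToOrder_fourier n _ fun i hi s => ?_
    rw [map_sub, sub_eq_zero]
    exact hg ⟨⟨i, hi⟩, s⟩
  refine ⟨fun ξ => divNormSq 1 (𝓕 (f - Δ g) : Sch d) ξ - (2 * Real.pi) ^ 2 • 𝓕 g ξ,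
    (hv.contDiff_divNormSq m le_rfl).sub
      (ContDiff.const_smul _ (mod_cast (𝓕 g).smooth m)), fun ξ => ?_⟩
  have h1 : ‖ξ‖ ^ 2 • divNormSq 1 (𝓕 (f - Δ g) : Sch d) ξ = 𝓕 (f - Δ g) ξ := by
    rcases eq_or_ne ξ 0 with rfl | hξ
    · rw [hv.apply_zero (by omega)]
      simp
    · have : ‖ξ‖ ^ 2 ≠ 0 := pow_ne_zero 2 (norm_ne_zero_iff.mpr hξ)
      rw [divNormSq, smul_smul, Nat.cast_one, zpow_neg_one, mul_inv_cancel₀ this, one_smul]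
  have h2 : 𝓕 (f - Δ g) ξ = 𝓕 f ξ - 𝓕 (Δ g) ξ := by
    have := map_sub (FourierTransform.fourierCLM ℂ (Sch d)) f (Δ g)
    exact congrArg (fun u : Sch d => u ξ) this
  rw [smul_sub, h1, h2, fourier_laplacian_apply]
  module

/-- A Schwartz function is the Laplacian of a Schwartz function as soon as it is orthogonal to
all harmonic polynomials. -/
theorem exists_laplacian_eq (hd : 2 ≤ d) (f : Sch d)
    (hf : ∀ k, ∀ p ∈ harmonicPoly d k, moment p f = 0) : ∃ g : Sch d, Δ g = f := by
  choose w hw hwf using exists_contDiff_norm_sq_smul_eq f hf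
  -- The quotients w m come from different g, yet agree off 0 and so everywhere by continuity; hence
  -- w 0 is C^m for every m.
  have hw0 : ContDiff ℝ ∞ (w 0) := by
    rw [contDiff_infty]
    intro m
    rw [eq_of_continuous_of_norm_sq_smul_eq hd (hw 0).continuous (hw m).continuous
      fun ξ => (hwf 0 ξ).symm.trans (hwf m ξ)]
    exact hw m
  let u : Sch d :=
    { toFun := w 0
      smooth' := hw0
      decay' := fun k j => exists_norm_pow_mul_iteratedFDeriv_le j 1 hw0 (𝓕 f)
        (fun ξ => by rw [pow_one]; exact hwf 0 ξ) k }
  refine ⟨𝓕⁻ ((-(2 * Real.pi) ^ 2 : ℝ)⁻¹ • u), ?_⟩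
  have h1 : (𝓕 (Δ (𝓕⁻ ((-(2 * Real.pi) ^ 2 : ℝ)⁻¹ • u) : Sch d)) : Sch d) = 𝓕 f := by
    ext ξ
    have h3 : -(2 * Real.pi) ^ 2 ≠ 0 := neg_ne_zero.mpr (pow_ne_zero 2 Real.two_pi_pos.ne')
    rw [fourier_laplacian_apply, FourierTransform.fourier_fourierInv_eq, smul_apply,
      smul_comm (‖ξ‖ ^ 2), smul_smul, mul_inv_cancel₀ h3, one_smul]
    exact (hwf 0 ξ).symm
  rw [← FourierTransform.fourierInv_fourier_eq f (F := Sch d), ← h1,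
    FourierTransform.fourierInv_fourier_eq]

end Fourier

/-! ### Kernel of π⁰ and dimension of its image -/

section Main

variable {d : ℕ}

theorem bvOperator_zero_apply (f : Sch d) : bvOperator d 0 f = Δ f := by
  simp [bvOperator]

/-- Linear independence of the φₖⱼ makes every coefficient vanish. Since 𝓗ₖ is stable under
conjugation, pairings with the basis and moments against all of 𝓗ₖ vanish together, whatever the
basis. -/
theorem piTilde_eq_zero_iff {N : ℕ → ℕ} (φ : HarmonicBasis d N) (f : Sch d) :
    piTilde φ f = 0 ↔ ∀ k, ∀ p ∈ harmonicPoly d k, moment p f = 0 := by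
  rw [funext_iff]
  refine forall_congr' fun k => ?_
  have h1 : piTilde φ f k = ∑ j, pairing (φ k j : MvPolynomial (Fin d) ℂ) f • φ k j := by
    simp [piTilde]
  rw [h1]
  constructor
  · intro h p hp
    have hj : ∀ j, pairing (φ k j : MvPolynomial (Fin d) ℂ) f = 0 :=
      Fintype.linearIndependent_iff.mp (φ k).linearIndependent _ h
    have hp' := map_conj_mem_harmonicPoly hp
    have h2 := (φ k).sum_repr ⟨_, hp'⟩
    have h3 := congrArg (MvPolynomial.map (starRingEnd ℂ)) (congrArg Subtype.val h2)
    rw [map_conj_map_conj] at h3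
    rw [← h3]
    simp only [AddSubmonoidClass.coe_finsetSum, SetLike.val_smul, map_sum,
      MvPolynomial.smul_eq_C_mul, map_mul, MvPolynomial.map_C, LinearMap.sum_apply]
    refine Finset.sum_eq_zero fun j _ => ?_
    rw [← MvPolynomial.smul_eq_C_mul, map_smul, ← pairing_eq_moment, LinearMap.smul_apply, hj,
      smul_zero]
  · intro h
    refine Finset.sum_eq_zero fun j _ => ?_
    rw [pairing_eq_moment, h _ (map_conj_mem_harmonicPoly (φ k j).2), zero_smul]

theorem piZero_eq_zero_iff {N : ℕ → ℕ} (φ : HarmonicBasis d N) (f : Sch d) :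
    piZero φ f = 0 ↔ ∀ k, ∀ p ∈ harmonicPoly d k, moment p f = 0 :=
  Subtype.ext_iff.trans (piTilde_eq_zero_iff φ f)

theorem ker_piZero (hd : 2 ≤ d) {N : ℕ → ℕ} (φ : HarmonicBasis d N) :
    LinearMap.ker (piZero φ) = LinearMap.range (bvOperator d 0) := by
  ext f
  rw [LinearMap.mem_ker, piZero_eq_zero_iff]
  constructor
  · intro h
    obtain ⟨g, hg⟩ := exists_laplacian_eq hd f h
    exact ⟨g, (bvOperator_zero_apply g).trans hg⟩
  · rintro ⟨g, rfl⟩ k p hp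
    have h : polyLaplacian d p = 0 := hp.2
    rw [bvOperator_zero_apply, moment_laplacian, h, map_zero, LinearMap.zero_apply]

theorem bvOperator_zero_injective (hd : 2 ≤ d) : Function.Injective (bvOperator d 0) := by
  rw [← LinearMap.ker_eq_bot, LinearMap.ker_eq_bot']
  intro g hg
  exact laplacian_injective hd ((bvOperator_zero_apply g).symm.trans hg)

/-- The linear form `x + iy` in two of the coordinates. -/
def holomorphicCoord (i j : Fin d) : MvPolynomial (Fin d) ℂ :=
  MvPolynomial.X i + MvPolynomial.C Complex.I * MvPolynomial.X j

theorem holomorphicCoord_pow_mem {i j : Fin d} (hij : i ≠ j) (k : ℕ) :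
    holomorphicCoord i j ^ k ∈ harmonicPoly d k := by
  constructor
  · have h : (holomorphicCoord i j).IsHomogeneous 1 :=
      (MvPolynomial.isHomogeneous_X ℂ i).add ((MvPolynomial.isHomogeneous_X ℂ j).C_mul _)
    simpa using h.pow k
  · change polyLaplacian d _ = 0
    have hC : (MvPolynomial.C Complex.I * MvPolynomial.C Complex.I : MvPolynomial (Fin d) ℂ) =
        -1 := by
      rw [← MvPolynomial.C_mul, Complex.I_mul_I, MvPolynomial.C_neg, MvPolynomial.C_1]
    have hd : ∀ l, MvPolynomial.pderiv l (holomorphicCoord i j) =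
        MvPolynomial.C ((Pi.single i 1 : Fin d → ℂ) l + Complex.I * (Pi.single j 1 : Fin d → ℂ) l) := by
      intro l
      simp only [holomorphicCoord, map_add, MvPolynomial.pderiv_C_mul, MvPolynomial.pderiv_X,
        Pi.single_apply, map_mul]
      congr 1
      · rw [apply_ite (MvPolynomial.C (σ := Fin d) (R := ℂ)), map_one, map_zero]
        simp only [eq_comm]
      · rw [apply_ite (MvPolynomial.C (σ := Fin d) (R := ℂ)), map_one, map_zero]
        simp only [eq_comm]
    rw [polyLaplacian_apply]
    have h2 : ∀ l, MvPolynomial.pderiv l (MvPolynomial.pderiv l (holomorphicCoord i j ^ k)) =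
        MvPolynomial.C (((Pi.single i 1 : Fin d → ℂ) l + Complex.I * (Pi.single j 1 : Fin d → ℂ) l) ^ 2) *
          ((k : MvPolynomial (Fin d) ℂ) * (((k - 1 : ℕ) : MvPolynomial (Fin d) ℂ) *
            holomorphicCoord i j ^ (k - 1 - 1))) := by
      intro l
      rw [MvPolynomial.pderiv_pow, hd]
      simp only [Derivation.leibniz, MvPolynomial.pderiv_C,
        Derivation.map_natCast, MvPolynomial.pderiv_pow, hd, smul_eq_mul, map_pow]
      ring
    simp only [h2]
    rw [← Finset.sum_mul, ← map_sum]
    -- The isotropy relation 1² + I² = 0, which makes every power of x + iy harmonic.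
    have h3 : ∑ l, ((Pi.single i 1 : Fin d → ℂ) l + Complex.I * (Pi.single j 1 : Fin d → ℂ) l) ^ 2 = 0 := by
      have h4 : ∀ l, ((Pi.single i 1 : Fin d → ℂ) l + Complex.I * (Pi.single j 1 : Fin d → ℂ) l) ^ 2 =
          (if l = i then 1 else 0) - if l = j then 1 else 0 := by
        intro l
        simp only [Pi.single_apply]
        split_ifs <;> simp_all
      simp [h4]
    rw [h3, map_zero, zero_mul]

theorem aeval_holomorphicCoord_injective {i j : Fin d} (hij : i ≠ j) :
    Function.Injective (Polynomial.aeval (R := ℂ) (holomorphicCoord i j)) := by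
  -- Setting the i-th coordinate to X and all others to 0 is a left inverse.
  have h : (MvPolynomial.aeval (R := ℂ) (Pi.single i Polynomial.X : Fin d → Polynomial ℂ)).comp
      (Polynomial.aeval (holomorphicCoord i j)) = AlgHom.id ℂ _ := by
    ext
    simp [holomorphicCoord, hij.symm]
  refine Function.LeftInverse.injective (g := MvPolynomial.aeval (R := ℂ)
    (Pi.single i Polynomial.X : Fin d → Polynomial ℂ)) fun q => ?_
  exact DFunLike.congr_fun h q

/-- A functional that kills ker π comes from the dual of H; if H were finite-dimensional, ℂ[X] would
embed in a finite-dimensional space. -/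
theorem aleph0_le_rank_of_injective_dual {V H : Type} [AddCommGroup V] [Module ℂ V]
    [AddCommGroup H] [Module ℂ H] (π : V →ₗ[ℂ] H) (Ψ : Polynomial ℂ →ₗ[ℂ] Module.Dual ℂ V)
    (hΨ : Function.Injective Ψ) (h : ∀ q f, π f = 0 → Ψ q f = 0) :
    Cardinal.aleph0 ≤ Module.rank ℂ H := by
  by_contra! hlt
  have hfin : FiniteDimensional ℂ H := Module.rank_lt_aleph0_iff.mp hlt
  have hrange : ∀ q, Ψ q ∈ LinearMap.range π.dualMap := by
    intro q
    rw [LinearMap.range_dualMap_eq_dualAnnihilator_ker, Submodule.mem_dualAnnihilator]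
    exact fun f hf => h q f hf
  have : FiniteDimensional ℂ (Polynomial ℂ) :=
    Module.Finite.of_injective (Ψ.codRestrict _ hrange)
      fun a b hab => hΨ (congrArg Subtype.val hab)
  exact Polynomial.not_finite this

theorem aleph0_le_rank_harmonicTilde (hd : 2 ≤ d) {N : ℕ → ℕ} (φ : HarmonicBasis d N) :
    Cardinal.aleph0 ≤ Module.rank ℂ (harmonicTilde φ) := by
  let i : Fin d := ⟨0, by omega⟩
  let j : Fin d := ⟨1, by omega⟩
  have hij : i ≠ j := by simp [i, j]
  let Ψ : Polynomial ℂ →ₗ[ℂ] Module.Dual ℂ (Sch d) :=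
    moment ∘ₗ (Polynomial.aeval (holomorphicCoord i j)).toLinearMap
  have hΨ : Function.Injective Ψ :=
    moment_injective.comp (aeval_holomorphicCoord_injective hij)
  refine aleph0_le_rank_of_injective_dual (H := harmonicTilde φ) (piZero φ) Ψ hΨ fun q f hf => ?_
  have hf' := (piZero_eq_zero_iff φ f).mp hf
  simp only [Ψ, LinearMap.comp_apply, AlgHom.toLinearMap_apply,
    Polynomial.aeval_eq_sum_range, map_sum, map_smul, LinearMap.sum_apply, LinearMap.smul_apply]
  exact Finset.sum_eq_zero fun k _ => by
    rw [hf' k _ (holomorphicCoord_pow_mem hij k), smul_zero]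

end Main

end SchwartzObs

end

theorem mainTheorem5 (d : ℕ) (hd : 2 ≤ d) (N : ℕ → ℕ) (φ : SchwartzObs.HarmonicBasis d N) :
    (∃ e : (SchwartzObs.obsCl d 0).homology 0 ≃ₗ[ℂ]
        SymmetricAlgebra ℂ (SchwartzObs.harmonicTilde φ),
      ∀ P : SymmetricAlgebra ℂ (SchwartzObs.Sch d),
        e (SchwartzObs.obsClass d 0 P) = SchwartzObs.symPiZero φ P) ∧
    (∀ n : ℤ, n ≠ 0 → CategoryTheory.Limits.IsZero ((SchwartzObs.obsCl d 0).homology n)) ∧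
    Cardinal.aleph0 ≤ Module.rank ℂ (SchwartzObs.harmonicTilde φ) :=
  ⟨SchwartzObs.exists_homologyEquiv_of_addCommMonoid (SchwartzObs.bvOperator d 0) (SchwartzObs.piZero φ)
      (LinearMap.surjective_rangeRestrict _) (SchwartzObs.ker_piZero hd φ),
    fun n hn => SchwartzObs.isZero_homology_symComplex _
      (SchwartzObs.bvOperator_zero_injective hd) n hn,
    SchwartzObs.aleph0_le_rank_harmonicTilde hd φ⟩
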